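/- **Setting.** Let $C$ be a proper open convex cone in a finite-dimensional real vector space $V$: $C$ is open, convex, invariant under multiplication by positive scalars, and $\overline C\cap(-\overline C)=\{0\}$. Write $x\le_C y$ if $y-x\in\overline C$, and $$M(x,y):=\inf\{\lambda>0 \mid x\le_C\lambda y\}\quad (x\in V,\ y\in C),$$ $$d_F(x,y):=\log M(x,y),\qquad d_R(x,y):=d_F(y,x),$$ $$d_H(x,y):=\log\big(M(x,y)M(y,x)\big),\qquad d_T(x,y):=\log\max\big(M(x,y),M(y,x)\big)$$ (the Funk, reverse-Funk, Hilbert and Thompson distances). Let $\varphi$ be a linear functional that is positive on $\overline C\setminus\{0\}$, let $D:=\{x\in C\mid\varphi(x)=1\}$, let $\partial D:=\overline D\setminus D$ be its (relative) boundary, and fix a base-point $b\in D$. **Horofunctions.** Let $(X,d)$ be one of $(C,d_T)$, $(D,d_F)$, $(D,d_R)$. For $z\in X$ let $\psi_z:=d(\cdot,z)-d(b,z)$, and give the real functions on $X$ the topology of uniform convergence on sets bounded for $d(x,y)+d(y,x)$. A *horofunction* is an element of $\overline{\{\psi_z\mid z\in X\}}\setminus\{\psi_z\mid z\in X\}$.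 An *almost-geodesic* is a map $\gamma\colon T\to X$, where $T\subset[0,\infty)$ contains $0$ and $\sup T\in(0,\infty]$ is a limit point, but not an element, of $T$, such that for each $\epsilon>0$ there is $N<\sup T$ with $|d(\gamma(0),\gamma(s))+d(\gamma(s),\gamma(t))-t|<\epsilon$ for all $s,t\in T$ with $N\le s\le t$. A *Busemann point* is a horofunction $\xi$ such that $\psi_{\gamma(t)}\to\xi$ as $t\to\sup T$ for some almost-geodesic $\gamma$. The *detour cost* is $$H(\xi,\eta):=\sup_{W\ni\xi}\ \inf_{z\in X,\ \psi_z\in W}\big(d(b,z)+\eta(z)\big),$$ with $W$ ranging over the neighbourhoods of $\xi$, and the *detour distance* is $\delta(\xi,\eta):=H(\xi,\eta)+H(\eta,\xi)\in[0,\infty]$. For $u,v\in[-\infty,0]$ put $H(\xi+u,\eta+v):=H(\xi,\eta)+v-u$, where $-\infty$ is absorbing for addition: $(+\infty)+(-\infty)=-\infty=(-\infty)-(-\infty)$. **The functions.** For $x\in\overline D$ let $r_x:=d_R(\cdot,x)-d_R(b,x)$, and for $x\in D$ let $f_{C,x}:=\log\big(M(\cdot,x)/M(b,x)\big)$. For $x\in\partial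 D$ let $B(x)$ be the set of Busemann points $f$ of $(D,d_F)$ for which some sequence in $D$ converges both to $x$ in the usual topology and to $f$ in the Funk geometry; such an $f$ is extended to $C$ by $f(z):=f(z/\varphi(z))+\log\varphi(z)$. For $c\in[-\infty,\infty]$ let $c^-:=\min(c,0)$, $c^+:=\max(c,0)$ and $[r_x,f,c]:=\max(r_x+c^-,\,f-c^+)$. **Statement.** Let $\delta$ be the detour distance of the Thompson geometry $(C,d_T)$ with base-point $b$. 1. For $x,y\in D$: $\delta(r_x,r_y)=d_H(x,y)$. 2. For $x,y\in D$: $\delta(f_{C,x},f_{C,y})=d_H(x,y)$. 3. For $x,x'\in\partial D$, $f\in B(x)$, $f'\in B(x')$ and $c,c'\in[-\infty,\infty]$: $$\delta\big([r_x,f,c],[r_{x'},f',c']\big)=\max\big(H(\bar r_x,\bar r_{x'}),H(\bar f,\bar f')\big)+\max\big(H(\bar r_{x'},\bar r_x),H(\bar f',\bar f)\big),$$ where $\bar r_x:=r_x+c^-$, $\bar f:=f-c^+$, $\bar r_{x'}:=r_{x'}+c'^-$, $\bar f':=f'-c'^+$, the costs of $\bar r$'s are those of the reverse-Funk geometry $(D,d_R)$,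 and the costs of $\bar f$'s are those of the Funk geometry $(D,d_F)$. 4. If $\xi$ and $\eta$ are Busemann points of $(C,d_T)$ and the pair $(\xi,\eta)$ is of none of the kinds in 1, 2 and 3, then $\delta(\xi,\eta)=\infty$. -/

import Mathlib

open Filter Topology Set
open scoped UniformConvergence

namespace ThompsonGeometry

noncomputable section

/-! ### Horofunctions, Busemann points and the detour cost

`X` is a space with a (possibly asymmetric) distance function `d` and a base-point `b`. -/

section Horofunctions

variable {X : Type*}

/-- The sets that are bounded for the symmetrised distance `d x y + d y x`. -/
def boundedSets (d : X → X → ℝ) : Set (Set X) :=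
  {B | ∃ r : ℝ, ∀ x ∈ B, ∀ y ∈ B, d x y + d y x ≤ r}

/-- The function `ψ_z = d(·, z) - d(b, z)`. -/
def distFun (d : X → X → ℝ) (b z : X) : X → ℝ := fun x => d x z - d b z

/-- A function on `X`, seen as a point of the space of real functions on `X` with the topology of
uniform convergence on bounded sets. (The continuous functions form a closed subspace of it, so
closures may be taken in the whole space.) -/
def toFunSpace (d : X → X → ℝ) (f : X → ℝ) : X →ᵤ[boundedSets d] ℝ :=
  UniformOnFun.ofFun (boundedSets d) f

/-- Horofunctions: limits of functions `ψ_z` that are not themselves of this form. -/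
def IsHorofunction (d : X → X → ℝ) (b : X) (ξ : X → ℝ) : Prop :=
  toFunSpace d ξ ∈ closure (range fun z => toFunSpace d (distFun d b z)) ∧
    ξ ∉ range (distFun d b)

/-- Almost-geodesics. The domain `T` is a set of non-negative reals containing `0` and without a
largest element, that is, `sup T` (which may be `+∞`) is a limit point of `T` not lying in `T`. -/
structure IsAlmostGeodesic (d : X → X → ℝ) (T : Set ℝ) (γ : T → X) : Prop where
  nonneg : ∀ t ∈ T, 0 ≤ t
  zero_mem : (0 : ℝ) ∈ T
  no_max : ∀ s ∈ T, ∃ t ∈ T, s < t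
  almost : ∀ ε > 0, ∃ N : T, ∀ s t : T, N ≤ s → s ≤ t →
    |d (γ ⟨0, zero_mem⟩) (γ s) + d (γ s) (γ t) - t| < ε

/-- Busemann points: horofunctions that are limits of almost-geodesics, as the parameter tends
to `sup T`. -/
def IsBusemann (d : X → X → ℝ) (b : X) (ξ : X → ℝ) : Prop :=
  IsHorofunction d b ξ ∧
    ∃ (T : Set ℝ) (γ : T → X), IsAlmostGeodesic d T γ ∧
      Tendsto (fun t : T => toFunSpace d (distFun d b (γ t))) atTop (𝓝 (toFunSpace d ξ))

/-- The detour cost `H(ξ, η) = sup_{W ∋ ξ} inf_{z ∈ W ∩ X} (d(b, z) + η(z))`, where `W` runs over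
the neighbourhoods of `ξ`, and `z ∈ X` is identified with `ψ_z`. -/
def detourCost (d : X → X → ℝ) (b : X) (ξ η : X → ℝ) : EReal :=
  ⨆ W ∈ 𝓝 (toFunSpace d ξ), ⨅ z ∈ {z : X | toFunSpace d (distFun d b z) ∈ W},
    ((d b z + η z : ℝ) : EReal)

/-- The detour distance `δ(ξ, η) = H(ξ, η) + H(η, ξ)`. -/
def detourDist (d : X → X → ℝ) (b : X) (ξ η : X → ℝ) : EReal :=
  detourCost d b ξ η + detourCost d b η ξ

/-- The extension `H(ξ + u, η + v) = H(ξ, η) + v - u` to shifts `u, v ∈ [-∞, 0]`.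
In `EReal`, `⊥` is absorbing for addition: `⊤ + ⊥ = ⊥` and `⊥ - ⊥ = ⊥`. -/
def shiftedDetourCost (d : X → X → ℝ) (b : X) (ξ : X → ℝ) (u : EReal) (η : X → ℝ) (v : EReal) :
    EReal :=
  detourCost d b ξ η + v - u

/-- `[f₁, f₂, c] = max (f₁ + c⁻) (f₂ - c⁺)`, where `c⁻ = min c 0` and `c⁺ = max c 0`.
The maximum is always finite. -/
def bracket (f₁ f₂ : X → ℝ) (c : EReal) : X → ℝ := fun z =>
  (max ((f₁ z : EReal) + min c 0) ((f₂ z : EReal) - max c 0)).toReal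

end Horofunctions

/-! ### Cones and their metrics -/

section Cones

variable {E : Type*} [NormedAddCommGroup E] [NormedSpace ℝ E]

/-- Proper open convex cones. -/
structure IsProperOpenConvexCone (C : Set E) : Prop where
  isOpen : IsOpen C
  convex : Convex ℝ C
  smul_mem : ∀ t : ℝ, 0 < t → ∀ x ∈ C, t • x ∈ C
  pointed : closure C ∩ -closure C = {0}

/-- The gauge `M_C(x, y) = inf {t > 0 | x ≤_C t y}`, where `x ≤_C z` means `z - x ∈ closure C`. -/
def coneGauge (C : Set E) (x y : E) : ℝ := sInf {t : ℝ | 0 < t ∧ t • y - x ∈ closure C}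

/-- The Funk metric. -/
def funk (C : Set E) (x y : E) : ℝ := Real.log (coneGauge C x y)

/-- The reverse-Funk metric. -/
def revFunk (C : Set E) (x y : E) : ℝ := funk C y x

/-- Hilbert's projective metric. -/
def hilbert (C : Set E) (x y : E) : ℝ := Real.log (coneGauge C x y * coneGauge C y x)

/-- Thompson's metric. -/
def thompson (C : Set E) (x y : E) : ℝ := Real.log (max (coneGauge C x y) (coneGauge C y x))

/-- The function `r_x = R(·, x) - R(b, x)`. -/
def rFun (C : Set E) (b x : E) : E → ℝ := fun z => revFunk C z x - revFunk C b x

/-- The function `f_{C,x} = log (M_C(·, x) / M_C(b, x))`. -/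
def fFun (C : Set E) (b x : E) : E → ℝ := fun z => Real.log (coneGauge C z x / coneGauge C b x)

/-- A linear functional that is (strictly) positive on the non-zero elements of `closure C`. -/
def IsPositiveOn (C : Set E) (φ : E →ₗ[ℝ] ℝ) : Prop := ∀ x ∈ closure C, x ≠ 0 → 0 < φ x

/-- The cross section `D = {x ∈ C | φ x = 1}`. -/
def crossSection (C : Set E) (φ : E →ₗ[ℝ] ℝ) : Set E := {x | x ∈ C ∧ φ x = 1}

/-- The boundary `∂D` of the cross section. As `D` is relatively open, it is `closure D \ D`. -/
def sectionBoundary (C : Set E) (φ : E →ₗ[ℝ] ℝ) : Set E :=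
  closure (crossSection C φ) \ crossSection C φ

variable {C : Set E} {φ : E →ₗ[ℝ] ℝ} {b : E}

theorem pos_of_mem (hC : IsProperOpenConvexCone C) (hφ : IsPositiveOn C φ)
    (hb : b ∈ crossSection C φ) {z : E} (hz : z ∈ C) : 0 < φ z := by
  refine hφ z (subset_closure hz) ?_
  rintro rfl
  have hcont : Tendsto (fun t : ℝ => t • (-b)) (𝓝[>] 0) (𝓝 0) := by
    have : Continuous fun t : ℝ => t • (-b) := by fun_prop
    simpa using (this.tendsto 0).mono_left nhdsWithin_le_nhds
  obtain ⟨t, htC, ht⟩ := ((hcont.eventually (hC.isOpen.mem_nhds hz)).and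
    self_mem_nhdsWithin).exists
  have ht' : (0 : ℝ) < t := ht
  have hb0 : b ≠ 0 := by
    rintro rfl
    simpa using hb.2
  have h := hφ _ (subset_closure htC) (smul_ne_zero ht'.ne' (neg_ne_zero.mpr hb0))
  rw [map_smul, map_neg, hb.2, smul_eq_mul] at h
  linarith

/-- The point of the cross section on the ray through `z`. -/
def toSection (hC : IsProperOpenConvexCone C) (hφ : IsPositiveOn C φ) (hb : b ∈ crossSection C φ)
    (z : C) : crossSection C φ :=
  ⟨(φ z)⁻¹ • (z : E), hC.smul_mem _ (inv_pos.mpr (pos_of_mem hC hφ hb z.2)) _ z.2, by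
    rw [map_smul, smul_eq_mul, inv_mul_cancel₀ (pos_of_mem hC hφ hb z.2).ne']⟩

/-- The extension to `C` of a Funk horofunction `f` on `D`: the logarithm of a function that is
homogeneous of degree one. -/
def extendToCone (hC : IsProperOpenConvexCone C) (hφ : IsPositiveOn C φ)
    (hb : b ∈ crossSection C φ) (f : crossSection C φ → ℝ) : C → ℝ :=
  fun z => f (toSection hC hφ hb z) + Real.log (φ z)

/-- The Funk distance on `D`. -/
def funkD (C : Set E) (φ : E →ₗ[ℝ] ℝ) (x y : crossSection C φ) : ℝ := funk C x y

/-- The reverse-Funk distance on `D`. -/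
def revFunkD (C : Set E) (φ : E →ₗ[ℝ] ℝ) (x y : crossSection C φ) : ℝ := revFunk C x y

/-- The Thompson distance on `C`. -/
def thompsonC (C : Set E) (x y : C) : ℝ := thompson C x y

/-- `B(x)`: the Busemann points of the Funk geometry on `D` that are approached by a sequence
in `D` converging to `x` in the usual topology. -/
def funkBusemannAt (C : Set E) (φ : E →ₗ[ℝ] ℝ) (b : crossSection C φ) (x : E) :
    Set (crossSection C φ → ℝ) :=
  {f | IsBusemann (funkD C φ) b f ∧ ∃ z : ℕ → crossSection C φ,
    Tendsto (fun n => (z n : E)) atTop (𝓝 x) ∧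
    Tendsto (fun n => toFunSpace (funkD C φ) (distFun (funkD C φ) b (z n))) atTop
      (𝓝 (toFunSpace (funkD C φ) f))}

/-- The function `r_x` on `C`. -/
def rC (C : Set E) (b x : E) : C → ℝ := fun z => rFun C b x z

/-- The function `r_x` on `D`. -/
def rD (C : Set E) (φ : E →ₗ[ℝ] ℝ) (b x : E) : crossSection C φ → ℝ := fun z => rFun C b x z

/-- The function `f_{C,x}` on `C`. -/
def fC (C : Set E) (b x : E) : C → ℝ := fun z => fFun C b x z

end Cones

end

end ThompsonGeometry

/-! The detour cost becomes computable through one formula. Say that `ξ` has zero detour if it is a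
limit of functions `ψ_z` along a filter on which `d(b, z) + ξ(z) → 0`. For such `ξ` and every
nonexpansive `η`, `H(ξ, η) = sup_p (η(p) - ξ(p))` (`HasZeroDetour.detourCost_eq`). Busemann points
have zero detour (`IsBusemann.hasZeroDetour`), so the theorem reduces to computing suprema and to
knowing the shape of the Thompson Busemann points.

With `F` the Funk distance, the Thompson distance is `max(F(x, y), F(y, x))`, so `ψ_z` is the
bracket of `r_z`, `f_z` and the number `F(z, b) - F(b, z)` (`distFun_thompsonC`). Multiplying `z` by
a positive scalar leaves `r_z` and `f_z` unchanged and gives that number any prescribed real value.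
As functions of the argument, the reverse-Funk and Funk functions have opposite homogeneity: scaling
by `exp s` subtracts `s` from the former and adds `s` to the latter. On each ray either entry of a
bracket with finite parameter can therefore be made the dominant one, so the supremum of a
difference of brackets splits into a maximum of a reverse-Funk and a Funk supremum
(`iSup_bracket_sub_bracket`). This gives the third formula. In the first two, the supremum is
attained at `p = x` by the triangle inequality.

The formula applies to all brackets `[r_x, f, c]` with `f ∈ B(x)` because one family in `C` makes
the detour costs of `r_x` and of `f` to themselves vanish together: the points `x + ε γ`, with `γ`
running to `f` and `ε → 0` (`exists_common_detour`). Rescaling this family handles every `c`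
(`hasZeroDetour_bracket`).

Conversely, compactness of the section and of the extended reals shows that every Thompson Busemann
point is some `r_x` or `f_{C,x}` with `x ∈ D`, or a bracket at a boundary point
(`isBusemann_thompsonC`). For pairs of different types one of the two costs is infinite, either by
scaling or because `F(y, z) → ∞` as `z` approaches the boundary; as the other cost is non-negative,
the distance is infinite. -/

namespace ThompsonGeometry

/-! ### Detour costs and almost-geodesics in an asymmetric distance. -/

section General

variable {X : Type*} {d : X → X → ℝ} {b : X} {ξ η : X → ℝ}

/-- The axioms of a possibly asymmetric and possibly negative distance function. -/
structure IsAsymmDist (d : X → X → ℝ) : Prop where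
  self : ∀ x, d x x = 0
  triangle : ∀ x y z, d x z ≤ d x y + d y z

/-- Bounded sets are totally bounded. -/
def HasFiniteNets (d : X → X → ℝ) : Prop :=
  ∀ B ∈ boundedSets d, ∀ ε > 0, ∃ S : Finset X, ∀ x ∈ B, ∃ y ∈ S, d x y ≤ ε ∧ d y x ≤ ε

/-- Functions that are `1`-Lipschitz for an asymmetric distance. -/
def IsNonexpansive (d : X → X → ℝ) (η : X → ℝ) : Prop := ∀ p q, η p - η q ≤ d p q

theorem IsAsymmDist.isNonexpansive_distFun (hd : IsAsymmDist d) (z : X) :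
    IsNonexpansive d (distFun d b z) := fun p q => by
  have := hd.triangle p q z
  simp only [distFun]
  linarith

theorem isNonexpansive_of_tendsto {ι : Type*} {G : Filter ι} [NeBot G] {g : ι → X → ℝ}
    (hg : ∀ i, IsNonexpansive d (g i)) (h : ∀ p, Tendsto (fun i => g i p) G (𝓝 (ξ p))) :
    IsNonexpansive d ξ := fun p q =>
  le_of_tendsto ((h p).sub (h q)) (Eventually.of_forall fun i => hg i p q)

theorem tendsto_apply_of_tendsto_toFunSpace (hd : IsAsymmDist d) {ι : Type*} {G : Filter ι}
    {g : ι → X → ℝ} (h : Tendsto (fun i => toFunSpace d (g i)) G (𝓝 (toFunSpace d ξ))) (p : X) :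
    Tendsto (fun i => g i p) G (𝓝 (ξ p)) := by
  rw [UniformOnFun.tendsto_iff_tendstoUniformlyOn] at h
  refine (h {p} ⟨0, ?_⟩).tendsto_at (mem_singleton p)
  rintro x rfl y rfl
  simp [hd.self]

/-- For nonexpansive functions, uniform convergence on bounded sets is pointwise convergence. -/
theorem tendsto_toFunSpace (hn : HasFiniteNets d) {ι : Type*} {G : Filter ι}
    {g : ι → X → ℝ} (hg : ∀ i, IsNonexpansive d (g i))
    (h : ∀ p, Tendsto (fun i => g i p) G (𝓝 (ξ p))) :
    Tendsto (fun i => toFunSpace d (g i)) G (𝓝 (toFunSpace d ξ)) := by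
  rcases G.eq_or_neBot with rfl | _
  · exact tendsto_bot
  have hξ := isNonexpansive_of_tendsto hg h
  rw [UniformOnFun.tendsto_iff_tendstoUniformlyOn]
  intro B hB
  rw [Metric.tendstoUniformlyOn_iff]
  intro ε hε
  obtain ⟨S, hS⟩ := hn B hB (ε / 4) (by linarith)
  have hev : ∀ᶠ i in G, ∀ y ∈ S, |g i y - ξ y| < ε / 4 := by
    rw [Filter.eventually_all_finset]
    intro y _
    simpa [Real.dist_eq] using Metric.tendsto_nhds.1 (h y) (ε / 4) (by linarith)
  filter_upwards [hev] with i hi x hx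
  obtain ⟨y, hy, hxy, hyx⟩ := hS x hx
  have h1 := abs_lt.1 (hi y hy)
  have h2 := hg i x y
  have h3 := hg i y x
  have h4 := hξ x y
  have h5 := hξ y x
  change dist (ξ x) (g i x) < ε
  rw [Real.dist_eq, abs_lt]
  constructor <;> linarith

theorem tendsto_toFunSpace_distFun_iff (hd : IsAsymmDist d) (hn : HasFiniteNets d) {ι : Type*}
    {G : Filter ι} {u : ι → X} :
    Tendsto (fun i => toFunSpace d (distFun d b (u i))) G (𝓝 (toFunSpace d ξ)) ↔
      ∀ p, Tendsto (fun i => distFun d b (u i) p) G (𝓝 (ξ p)) :=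
  ⟨tendsto_apply_of_tendsto_toFunSpace hd,
    tendsto_toFunSpace hn fun i => hd.isNonexpansive_distFun (u i)⟩

/-- The function `ξ` is a limit of points along which its detour cost to itself vanishes. -/
def HasZeroDetour (d : X → X → ℝ) (b : X) (ξ : X → ℝ) : Prop :=
  ∃ G : Filter X, NeBot G ∧ (∀ p, Tendsto (fun z => distFun d b z p) G (𝓝 (ξ p))) ∧
    Tendsto (fun z => d b z + ξ z) G (𝓝 0)

theorem HasZeroDetour.of_tendsto {ι : Type*} {G : Filter ι} [NeBot G] {u : ι → X}
    (h : ∀ p, Tendsto (fun i => distFun d b (u i) p) G (𝓝 (ξ p)))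
    (h0 : Tendsto (fun i => d b (u i) + ξ (u i)) G (𝓝 0)) : HasZeroDetour d b ξ :=
  ⟨G.map u, inferInstance, fun p => tendsto_map'_iff.2 (h p), tendsto_map'_iff.2 h0⟩

theorem HasZeroDetour.exists_ultrafilter (h : HasZeroDetour d b ξ) :
    ∃ U : Ultrafilter X, (∀ p, Tendsto (fun z => distFun d b z p) U (𝓝 (ξ p))) ∧
      Tendsto (fun z => d b z + ξ z) U (𝓝 0) := by
  obtain ⟨G, _, h1, h2⟩ := h
  exact ⟨Ultrafilter.of G, fun p => (h1 p).mono_left (Ultrafilter.of_le G),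
    h2.mono_left (Ultrafilter.of_le G)⟩

theorem HasZeroDetour.isNonexpansive (hd : IsAsymmDist d) (h : HasZeroDetour d b ξ) :
    IsNonexpansive d ξ := by
  obtain ⟨G, _, h1, -⟩ := h
  exact isNonexpansive_of_tendsto (fun z => hd.isNonexpansive_distFun z) h1

theorem HasZeroDetour.apply_base (h : HasZeroDetour d b ξ) : ξ b = 0 := by
  obtain ⟨G, _, h1, -⟩ := h
  refine tendsto_nhds_unique (h1 b) ?_
  simp [distFun]

/-- Letting `t` tend to its supremum in the almost-geodesic inequality turns it into the smallness
of `d(o, γ(s)) + ξ(γ(s)) - ξ(o)`, where `o` is the starting point of the almost-geodesic, which need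
not be `b`. -/
theorem IsBusemann.hasZeroDetour (hd : IsAsymmDist d) (h : IsBusemann d b ξ) :
    HasZeroDetour d b ξ := by
  obtain ⟨-, T, γ, hγ, hlim⟩ := h
  have : Nonempty T := ⟨⟨0, hγ.zero_mem⟩⟩
  have hp := tendsto_apply_of_tendsto_toFunSpace hd hlim
  refine HasZeroDetour.of_tendsto hp ?_
  set o : X := γ ⟨0, hγ.zero_mem⟩
  have h1 : Tendsto (fun s : T => d o (γ s) + ξ (γ s) - ξ o) atTop (𝓝 0) := by
    rw [Metric.tendsto_nhds]
    intro ε hε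
    obtain ⟨N, hN⟩ := hγ.almost (ε / 4) (by linarith)
    filter_upwards [eventually_ge_atTop N] with s hs
    have hlim' : Tendsto (fun t => d o (γ s) + distFun d b (γ t) (γ s) - distFun d b (γ t) o)
        atTop (𝓝 (d o (γ s) + ξ (γ s) - ξ o)) := (tendsto_const_nhds.add (hp _)).sub (hp _)
    have hle : |d o (γ s) + ξ (γ s) - ξ o| ≤ ε / 2 := by
      refine le_of_tendsto hlim'.abs ?_
      filter_upwards [eventually_ge_atTop s] with t ht
      have e1 := abs_lt.1 (hN s t hs ht)
      -- The case `s = t` says that `t` is nearly `d(o, γ(t))`, which eliminates the parameter.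
      have e2 := abs_lt.1 (hN t t (hs.trans ht) le_rfl)
      rw [hd.self] at e2
      simp only [distFun]
      rw [abs_le]
      constructor <;> linarith
    rw [Real.dist_eq, sub_zero]
    linarith
  -- The base-point changes from `o` to `b`, since `d(o, γ(s)) - d(b, γ(s)) → ξ(o)`.
  have h2 := h1.add ((hp o).neg.add_const (ξ o))
  simp only [neg_add_cancel, add_zero] at h2
  refine h2.congr fun s => ?_
  simp only [distFun]
  ring

/-- Nonexpansiveness gives `d(b, z) + η(z) ≥ η(p) - ψ_z(p)`, and `ψ_z(p)` is close to `ξ(p)` when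
`ψ_z` is close to `ξ`. -/
theorem sub_le_detourCost (hd : IsAsymmDist d) (hη : IsNonexpansive d η) (p : X) :
    ((η p - ξ p : ℝ) : EReal) ≤ detourCost d b ξ η := by
  rw [← EReal.ge_of_forall_gt_iff_ge]
  intro c hc
  rw [EReal.coe_lt_coe_iff] at hc
  have hp := tendsto_apply_of_tendsto_toFunSpace (ξ := ξ) hd
    (G := comap (toFunSpace d) (𝓝 (toFunSpace d ξ))) (g := fun g => g) tendsto_comap p
  have hev := hp.eventually (gt_mem_nhds (show ξ p < η p - c by linarith))
  obtain ⟨W, hW, hWs⟩ := mem_comap.1 hev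
  refine le_trans ?_ (le_iSup₂ (f := fun W (_ : W ∈ 𝓝 (toFunSpace d ξ)) =>
    ⨅ z ∈ {z : X | toFunSpace d (distFun d b z) ∈ W}, ((d b z + η z : ℝ) : EReal)) W hW)
  refine le_iInf₂ fun z hz => ?_
  rw [EReal.coe_le_coe_iff]
  have h1 : distFun d b z p < η p - c := hWs hz
  have h2 := hη p z
  simp only [distFun] at h1
  linarith

theorem detourCost_nonneg (hd : IsAsymmDist d) (hη : IsNonexpansive d η) (hξb : ξ b = 0)
    (hηb : η b = 0) : 0 ≤ detourCost d b ξ η := by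
  simpa [hξb, hηb] using sub_le_detourCost (b := b) (ξ := ξ) hd hη b

/-- For the upper bound write `d(b, z) + η(z) = (d(b, z) + ξ(z)) + (η(z) - ξ(z))`; along the given
filter the first bracket tends to zero, and the second never exceeds the supremum. -/
theorem HasZeroDetour.detourCost_eq (hd : IsAsymmDist d) (hn : HasFiniteNets d)
    (hξ : HasZeroDetour d b ξ) (hη : IsNonexpansive d η) :
    detourCost d b ξ η = ⨆ p, ((η p - ξ p : ℝ) : EReal) := by
  refine le_antisymm ?_ (iSup_le fun p => sub_le_detourCost hd hη p)
  obtain ⟨G, _, h1, h2⟩ := hξ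
  refine iSup₂_le fun W hW => ?_
  rw [← EReal.le_of_forall_lt_iff_le]
  intro K hK
  obtain ⟨K', hK1, hK2⟩ := EReal.lt_iff_exists_real_btwn.1 hK
  rw [EReal.coe_lt_coe_iff] at hK2
  have e1 := ((tendsto_toFunSpace_distFun_iff hd hn (u := fun z => z)).2 h1).eventually hW
  have e2 := h2.eventually (gt_mem_nhds (sub_pos.2 hK2))
  obtain ⟨z, hz, hz'⟩ := (e1.and e2).exists
  refine (iInf₂_le z hz).trans ?_
  have h3 := (le_iSup (fun p => ((η p - ξ p : ℝ) : EReal)) z).trans hK1.le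
  rw [EReal.coe_le_coe_iff] at h3 ⊢
  linarith

/-- A sufficiently sparse subsequence works: `ψ` of each later point must be close to `ξ` at every
earlier one. Preceded by `b` and parametrised by the distance from `b`, it is an almost-geodesic. -/
theorem exists_isAlmostGeodesic (hd : IsAsymmDist d) {u : ℕ → X}
    (h1 : ∀ p, Tendsto (fun n => distFun d b (u n) p) atTop (𝓝 (ξ p)))
    (h2 : Tendsto (fun n => d b (u n) + ξ (u n)) atTop (𝓝 0))
    (h3 : Tendsto (fun n => d b (u n)) atTop atTop) :
    ∃ (T : Set ℝ) (γ : T → X), IsAlmostGeodesic d T γ ∧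
      ∀ p, Tendsto (fun t : T => distFun d b (γ t) p) atTop (𝓝 (ξ p)) := by
  obtain ⟨k, hk0, hk⟩ := exists_seq_of_forall_finset_exists (fun n => 0 < d b (u n))
    (fun m n => m < n ∧ d b (u m) < d b (u n) ∧
      |distFun d b (u n) (u m) - ξ (u m)| < 1 / ((m : ℝ) + 1)) (fun s _ => by
      have hev : ∀ᶠ n in atTop, ∀ m ∈ s, m < n ∧ d b (u m) < d b (u n) ∧
          |distFun d b (u n) (u m) - ξ (u m)| < 1 / ((m : ℝ) + 1) := by
        rw [Filter.eventually_all_finset]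
        intro m _
        refine (eventually_gt_atTop m).and ((h3.eventually_gt_atTop _).and ?_)
        simpa [Real.dist_eq] using
          Metric.tendsto_nhds.1 (h1 (u m)) (1 / ((m : ℝ) + 1)) (by positivity)
      exact ((h3.eventually_gt_atTop 0).and hev).exists)
  have hkmono : StrictMono k := fun m n hmn => (hk m n hmn).1
  let v : ℕ → X := fun n => Nat.casesOn n b fun m => u (k m)
  have hv : ∀ n, v (n + 1) = u (k n) := fun n => rfl
  let t : ℕ → ℝ := fun n => d b (v n)
  have ht0 : t 0 = 0 := hd.self b
  have htmono : StrictMono t := by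
    refine strictMono_nat_of_lt_succ fun n => ?_
    rcases n with _ | n
    · rw [ht0]; exact hk0 0
    · exact (hk n (n + 1) n.lt_succ_self).2.1
  let e : ℕ ≃o range t := htmono.orderIso t
  have he : ∀ n, (e n : ℝ) = t n := fun n => rfl
  have hvlim : ∀ p, Tendsto (fun n => distFun d b (v n) p) atTop (𝓝 (ξ p)) := fun p =>
    (tendsto_add_atTop_iff_nat 1).1 ((h1 p).comp hkmono.tendsto_atTop)
  have hmem : (0 : ℝ) ∈ range t := ⟨0, ht0⟩
  have he0 : e.symm ⟨0, hmem⟩ = 0 := by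
    rw [OrderIso.symm_apply_eq]
    exact Subtype.ext ht0.symm
  refine ⟨range t, fun s => v (e.symm s), ⟨?_, hmem, ?_, ?_⟩, fun p =>
    (hvlim p).comp e.symm.tendsto_atTop⟩
  · rintro _ ⟨n, rfl⟩
    rw [← ht0]
    exact htmono.monotone n.zero_le
  · rintro _ ⟨n, rfl⟩
    exact ⟨_, ⟨n + 1, rfl⟩, htmono n.lt_succ_self⟩
  · intro ε hε
    have ev1 : ∀ᶠ m in atTop, |d b (u (k m)) + ξ (u (k m))| < ε / 2 := by
      simpa [Real.dist_eq] using
        Metric.tendsto_nhds.1 (h2.comp hkmono.tendsto_atTop) (ε / 2) (by linarith)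
    have ev2 : ∀ᶠ m : ℕ in atTop, 1 / ((k m : ℝ) + 1) < ε / 2 :=
      (tendsto_one_div_add_atTop_nhds_zero_nat.comp hkmono.tendsto_atTop).eventually
        (gt_mem_nhds (by linarith))
    obtain ⟨N, hN⟩ := eventually_atTop.1 (ev1.and ev2)
    refine ⟨e (N + 1), ?_⟩
    intro s r hs hr
    obtain ⟨m, rfl⟩ := e.surjective s
    obtain ⟨n, rfl⟩ := e.surjective r
    rw [OrderIso.le_iff_le] at hs hr
    rw [he0, OrderIso.symm_apply_apply, OrderIso.symm_apply_apply, he]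
    change |d b (v m) + d (v m) (v n) - d b (v n)| < ε
    rcases hr.eq_or_lt with rfl | hr
    · simpa [hd.self] using hε
    obtain ⟨m, rfl⟩ : ∃ m', m = m' + 1 := ⟨m - 1, by omega⟩
    obtain ⟨n, rfl⟩ : ∃ n', n = n' + 1 := ⟨n - 1, by omega⟩
    obtain ⟨a1, a2⟩ := hN m (by omega)
    have a3 := abs_lt.1 ((hk m n (by omega)).2.2.trans a2)
    have a1 := abs_lt.1 a1
    rw [hv, hv]
    simp only [distFun] at a3
    rw [abs_lt]
    constructor <;> linarith

/-- The limit is not some `ψ_w`: for a non-negative distance `d(b, u n) + ψ_w(u n) ≥ d(b, u n) -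
d(b, w) → ∞`, against zero detour. -/
theorem isBusemann_of_seq (hd : IsAsymmDist d) (hn : HasFiniteNets d) (hpos : ∀ x y, 0 ≤ d x y)
    {u : ℕ → X} (h1 : ∀ p, Tendsto (fun n => distFun d b (u n) p) atTop (𝓝 (ξ p)))
    (h2 : Tendsto (fun n => d b (u n) + ξ (u n)) atTop (𝓝 0))
    (h3 : Tendsto (fun n => d b (u n)) atTop atTop) : IsBusemann d b ξ := by
  obtain ⟨T, γ, hγ, hlim⟩ := exists_isAlmostGeodesic hd h1 h2 h3
  refine ⟨⟨?_, ?_⟩, T, γ, hγ, (tendsto_toFunSpace_distFun_iff hd hn).2 hlim⟩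
  · exact mem_closure_of_tendsto ((tendsto_toFunSpace_distFun_iff hd hn).2 h1)
      (Eventually.of_forall fun n => mem_range_self _)
  · rintro ⟨w, rfl⟩
    refine not_tendsto_nhds_of_tendsto_atTop ?_ _ h2
    refine tendsto_atTop_mono (fun n => ?_) (tendsto_atTop_add_const_right _ (-d b w) h3)
    have := hpos (u n) w
    simp only [distFun]
    linarith

/-- The balls about `b` of integer radius exhaust the bounded sets. This allows a filter converging
to `f` to be replaced by a sequence. -/
theorem isCountablyGenerated_nhds_toFunSpace (hd : IsAsymmDist d) (b : X) (f : X → ℝ) :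
    IsCountablyGenerated (𝓝 (toFunSpace d f)) := by
  have : IsCountablyGenerated (uniformity (X →ᵤ[boundedSets d] ℝ)) := by
    refine UniformOnFun.isCountablyGenerated_uniformity (boundedSets d)
      (t := fun n : ℕ => {x | d b x + d x b ≤ n}) (fun n => ⟨2 * n, fun x hx y hy => ?_⟩)
      (fun m n hmn x hx => ?_) (fun B hB => ?_)
    · have h1 := hd.triangle x b y
      have h2 := hd.triangle y b x
      simp only [mem_ofPred] at hx hy
      linarith
    · have : (m : ℝ) ≤ n := by exact_mod_cast hmn
      simp only [mem_ofPred] at hx ⊢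
      linarith
    · obtain ⟨r, hr⟩ := hB
      rcases B.eq_empty_or_nonempty with rfl | ⟨y, hy⟩
      · exact ⟨0, empty_subset _⟩
      obtain ⟨n, hn⟩ := exists_nat_ge (d b y + d y b + r)
      refine ⟨n, fun x hx => ?_⟩
      have h1 := hd.triangle b y x
      have h2 := hd.triangle x y b
      have h3 := hr x hx y hy
      simp only [mem_ofPred]
      linarith
  infer_instance

end General

/-! ### The order of the cone and the Funk distance. -/

section ConeOrder

variable {E : Type*} [NormedAddCommGroup E] [NormedSpace ℝ E] {C : Set E}

namespace IsProperOpenConvexCone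

theorem smul_mem_closure (hC : IsProperOpenConvexCone C) {t : ℝ} (ht : 0 < t) {x : E}
    (hx : x ∈ closure C) : t • x ∈ closure C :=
  map_mem_closure (continuous_const_smul t) hx fun y hy => hC.smul_mem t ht y hy

theorem add_mem_closure (hC : IsProperOpenConvexCone C) {x y : E} (hx : x ∈ closure C)
    (hy : y ∈ closure C) : x + y ∈ closure C := by
  have h := hC.smul_mem_closure (t := 2) (by norm_num)
    (hC.convex.closure hx hy (a := 1 / 2) (b := 1 / 2) (by norm_num) (by norm_num) (by norm_num))
  simpa [smul_smul] using h

theorem zero_mem_closure (hC : IsProperOpenConvexCone C) : (0 : E) ∈ closure C :=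
  (hC.pointed.symm ▸ mem_singleton (0 : E) : (0 : E) ∈ closure C ∩ -closure C).1

theorem eq_zero_of_neg_mem (hC : IsProperOpenConvexCone C) {x : E} (hx : x ∈ closure C)
    (hx' : -x ∈ closure C) : x = 0 := by
  have : x ∈ closure C ∩ -closure C := ⟨hx, hx'⟩
  rwa [hC.pointed] at this

theorem add_mem (hC : IsProperOpenConvexCone C) {x y : E} (hx : x ∈ C) (hy : y ∈ closure C) :
    x + y ∈ C := by
  have h := hC.convex.combo_interior_closure_mem_interior (x := x) (y := y) (a := 1 / 2)
    (b := 1 / 2) (by rwa [hC.isOpen.interior_eq]) hy (by norm_num) (by norm_num) (by norm_num)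
  rw [hC.isOpen.interior_eq] at h
  have h := hC.smul_mem 2 (by norm_num) _ h
  simpa [smul_smul] using h

theorem exists_smul_sub_mem (hC : IsProperOpenConvexCone C) (x : E) {y : E} (hy : y ∈ C) :
    ∃ t : ℝ, 0 < t ∧ t • y - x ∈ closure C := by
  have hcont : Tendsto (fun t : ℝ => y - t • x) (𝓝[>] 0) (𝓝 y) := by
    have : Continuous fun t : ℝ => y - t • x := by fun_prop
    simpa using (this.tendsto 0).mono_left nhdsWithin_le_nhds
  obtain ⟨t, htC, ht⟩ := ((hcont.eventually (hC.isOpen.mem_nhds hy)).and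
    self_mem_nhdsWithin).exists
  have ht' : (0 : ℝ) < t := ht
  refine ⟨t⁻¹, inv_pos.2 ht', subset_closure ?_⟩
  have := hC.smul_mem t⁻¹ (inv_pos.2 ht') _ htC
  rwa [smul_sub, inv_smul_smul₀ ht'.ne'] at this

/-- The infimum is attained: pointedness excludes `t = 0`, so the admissible set equals the one
defined by `0 ≤ t`, which is closed. -/
theorem coneGauge_mem (hC : IsProperOpenConvexCone C) {x y : E} (hx : x ∈ closure C)
    (hx0 : x ≠ 0) (hy : y ∈ C) : 0 < coneGauge C x y ∧ coneGauge C x y • y - x ∈ closure C := by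
  have heq : {t : ℝ | 0 < t ∧ t • y - x ∈ closure C} = {t : ℝ | 0 ≤ t ∧ t • y - x ∈ closure C} := by
    ext t
    refine ⟨fun h => ⟨h.1.le, h.2⟩, fun h => ⟨h.1.lt_of_ne ?_, h.2⟩⟩
    rintro rfl
    exact hx0 (hC.eq_zero_of_neg_mem hx (by simpa using h.2))
  have hclosed : IsClosed {t : ℝ | 0 < t ∧ t • y - x ∈ closure C} := by
    rw [heq]
    have : Continuous fun t : ℝ => t • y - x := by fun_prop
    exact isClosed_Ici.inter (isClosed_closure.preimage this)
  exact hclosed.csInf_mem (hC.exists_smul_sub_mem x hy) ⟨0, fun t ht => ht.1.le⟩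

theorem coneGauge_le_iff (hC : IsProperOpenConvexCone C) {x y : E} (hx : x ∈ closure C)
    (hx0 : x ≠ 0) (hy : y ∈ C) {t : ℝ} (ht : 0 < t) :
    coneGauge C x y ≤ t ↔ t • y - x ∈ closure C := by
  refine ⟨fun h => ?_, fun h => csInf_le ⟨0, fun t ht => ht.1.le⟩ ⟨ht, h⟩⟩
  have h1 := (hC.coneGauge_mem hx hx0 hy).2
  rcases h.eq_or_lt with rfl | h
  · exact h1
  have h2 := hC.add_mem_closure h1 (hC.smul_mem_closure (sub_pos.2 h) (subset_closure hy))
  convert h2 using 1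
  module

end IsProperOpenConvexCone

/-- A proper open convex cone with a positive functional and a base-point in the cross section. -/
structure IsBasedCone (C : Set E) (φ : E →ₗ[ℝ] ℝ) (b : E) : Prop where
  cone : IsProperOpenConvexCone C
  positive : IsPositiveOn C φ
  base : b ∈ crossSection C φ

/-- The non-zero elements of the closure of the cone. -/
def puncturedClosure (C : Set E) : Set E := closure C \ {0}

namespace IsBasedCone

variable {φ : E →ₗ[ℝ] ℝ} {b : E} {x y z : E}

theorem mem_punctured (h : IsBasedCone C φ b) (hx : x ∈ C) : x ∈ puncturedClosure C := by
  refine ⟨subset_closure hx, ?_⟩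
  rintro rfl
  simpa using pos_of_mem h.cone h.positive h.base hx

theorem base_mem (h : IsBasedCone C φ b) : b ∈ C := h.base.1

theorem funk_le_iff (h : IsBasedCone C φ b) (hx : x ∈ puncturedClosure C) (hy : y ∈ C) {s : ℝ} :
    funk C x y ≤ s ↔ Real.exp s • y - x ∈ closure C := by
  rw [funk, Real.log_le_iff_le_exp (h.cone.coneGauge_mem hx.1 hx.2 hy).1,
    h.cone.coneGauge_le_iff hx.1 hx.2 hy (Real.exp_pos s)]

theorem exp_funk_smul_sub_mem (h : IsBasedCone C φ b) (hx : x ∈ puncturedClosure C) (hy : y ∈ C) :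
    Real.exp (funk C x y) • y - x ∈ closure C :=
  (h.funk_le_iff hx hy).1 le_rfl

theorem funk_triangle (h : IsBasedCone C φ b) (hx : x ∈ puncturedClosure C) (hy : y ∈ C)
    (hz : z ∈ C) : funk C x z ≤ funk C x y + funk C y z := by
  rw [h.funk_le_iff hx hz, Real.exp_add]
  have h1 := h.exp_funk_smul_sub_mem hx hy
  have h2 := h.exp_funk_smul_sub_mem (h.mem_punctured hy) hz
  convert h.cone.add_mem_closure h1
    (h.cone.smul_mem_closure (Real.exp_pos (funk C x y)) h2) using 1
  module

theorem funk_self (h : IsBasedCone C φ b) (hx : x ∈ C) : funk C x x = 0 := by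
  refine le_antisymm ?_ ?_
  · rw [h.funk_le_iff (h.mem_punctured hx) hx]
    simpa using h.cone.zero_mem_closure
  · have := h.funk_triangle (h.mem_punctured hx) hx hx
    linarith

theorem smul_mem_punctured (h : IsBasedCone C φ b) (hx : x ∈ puncturedClosure C) {t : ℝ}
    (ht : 0 < t) : t • x ∈ puncturedClosure C :=
  ⟨h.cone.smul_mem_closure ht hx.1, smul_ne_zero ht.ne' hx.2⟩

theorem funk_smul_left (h : IsBasedCone C φ b) (hx : x ∈ puncturedClosure C) (hy : y ∈ C) {t : ℝ}
    (ht : 0 < t) : funk C (t • x) y = funk C x y + Real.log t := by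
  have key : ∀ {x : E}, x ∈ puncturedClosure C → ∀ {t : ℝ}, 0 < t →
      funk C (t • x) y ≤ funk C x y + Real.log t := by
    intro x hx t ht
    rw [h.funk_le_iff (h.smul_mem_punctured hx ht) hy, Real.exp_add, Real.exp_log ht]
    convert h.cone.smul_mem_closure ht (h.exp_funk_smul_sub_mem hx hy) using 1
    module
  refine le_antisymm (key hx ht) ?_
  have := key (h.smul_mem_punctured hx ht) (inv_pos.2 ht)
  rw [inv_smul_smul₀ ht.ne', Real.log_inv] at this
  linarith

theorem funk_smul_right (h : IsBasedCone C φ b) (hx : x ∈ puncturedClosure C) (hy : y ∈ C) {t : ℝ}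
    (ht : 0 < t) : funk C x (t • y) = funk C x y - Real.log t := by
  have key : ∀ {y : E}, y ∈ C → ∀ {t : ℝ}, 0 < t →
      funk C x (t • y) ≤ funk C x y - Real.log t := by
    intro y hy t ht
    rw [h.funk_le_iff hx (h.cone.smul_mem t ht y hy), Real.exp_sub, Real.exp_log ht, smul_smul,
      div_mul_cancel₀ _ ht.ne']
    exact h.exp_funk_smul_sub_mem hx hy
  refine le_antisymm (key hy ht) ?_
  have := key (h.cone.smul_mem t ht y hy) (inv_pos.2 ht)
  rw [inv_smul_smul₀ ht.ne', Real.log_inv] at this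
  linarith

theorem thompson_eq (h : IsBasedCone C φ b) (hx : x ∈ C) (hy : y ∈ C) :
    thompson C x y = max (funk C x y) (funk C y x) := by
  have h1 := (h.cone.coneGauge_mem (subset_closure hx) (h.mem_punctured hx).2 hy).1
  have h2 := (h.cone.coneGauge_mem (subset_closure hy) (h.mem_punctured hy).2 hx).1
  unfold thompson funk
  rcases le_total (coneGauge C x y) (coneGauge C y x) with hle | hle
  · rw [max_eq_right hle, max_eq_right (Real.log_le_log h1 hle)]
  · rw [max_eq_left hle, max_eq_left (Real.log_le_log h2 hle)]

theorem hilbert_eq (h : IsBasedCone C φ b) (hx : x ∈ C) (hy : y ∈ C) :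
    hilbert C x y = funk C x y + funk C y x :=
  Real.log_mul (h.cone.coneGauge_mem (subset_closure hx) (h.mem_punctured hx).2 hy).1.ne'
    (h.cone.coneGauge_mem (subset_closure hy) (h.mem_punctured hy).2 hx).1.ne'

theorem fFun_eq (h : IsBasedCone C φ b) (hx : x ∈ C) (hz : z ∈ C) :
    fFun C b x z = funk C z x - funk C b x :=
  Real.log_div (h.cone.coneGauge_mem (subset_closure hz) (h.mem_punctured hz).2 hx).1.ne'
    (h.cone.coneGauge_mem (subset_closure h.base_mem) (h.mem_punctured h.base_mem).2 hx).1.ne'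

/-- Changing the level `s` strictly changes the vectors defining the inequality by, in the limit, a
positive multiple of `y`. This lies in the open cone and absorbs the error of convergence. -/
theorem tendsto_funk (h : IsBasedCone C φ b) {ι : Type*} {G : Filter ι} {u v : ι → E}
    (hu : Tendsto u G (𝓝 x)) (hv : Tendsto v G (𝓝 y)) (hu' : ∀ i, u i ∈ puncturedClosure C)
    (hv' : ∀ i, v i ∈ C) (hx : x ∈ puncturedClosure C) (hy : y ∈ C) :
    Tendsto (fun i => funk C (u i) (v i)) G (𝓝 (funk C x y)) := by
  have hmem : ∀ {s : ℝ}, 0 < s → s • y ∈ C := fun hs => h.cone.smul_mem _ hs y hy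
  rw [tendsto_order]
  constructor
  · intro s hs
    obtain ⟨s', hs1, hs2⟩ := exists_between hs
    have hlim : Tendsto (fun i => (Real.exp s' • y - x) - (Real.exp s • v i - u i)) G
        (𝓝 ((Real.exp s' - Real.exp s) • y)) := by
      convert (tendsto_const_nhds (x := Real.exp s' • y - x)).sub
        ((hv.const_smul (Real.exp s)).sub hu) using 2
      module
    filter_upwards [hlim.eventually (h.cone.isOpen.mem_nhds
      (hmem (sub_pos.2 (Real.exp_lt_exp.2 hs1))))] with i hi
    by_contra hle
    rw [not_lt, h.funk_le_iff (hu' i) (hv' i)] at hle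
    have := h.cone.add_mem hi hle
    rw [sub_add_cancel] at this
    exact absurd ((h.funk_le_iff hx hy).2 (subset_closure this)) (not_le.2 hs2)
  · intro s hs
    obtain ⟨s', hs1, hs2⟩ := exists_between hs
    have hlim : Tendsto (fun i => (Real.exp s' • v i - u i) - (Real.exp (funk C x y) • y - x)) G
        (𝓝 ((Real.exp s' - Real.exp (funk C x y)) • y)) := by
      convert ((hv.const_smul (Real.exp s')).sub hu).sub
        (tendsto_const_nhds (x := Real.exp (funk C x y) • y - x)) using 2
      module
    filter_upwards [hlim.eventually (h.cone.isOpen.mem_nhds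
      (hmem (sub_pos.2 (Real.exp_lt_exp.2 hs1))))] with i hi
    refine lt_of_le_of_lt ?_ hs2
    rw [h.funk_le_iff (hu' i) (hv' i)]
    have := h.cone.add_mem hi (h.exp_funk_smul_sub_mem hx hy)
    rw [sub_add_cancel] at this
    exact subset_closure this

theorem tendsto_funk_left (h : IsBasedCone C φ b) {ι : Type*} {G : Filter ι} {u : ι → E}
    (hu : Tendsto u G (𝓝 x)) (hu' : ∀ i, u i ∈ puncturedClosure C)
    (hx : x ∈ puncturedClosure C) (hy : y ∈ C) :
    Tendsto (fun i => funk C (u i) y) G (𝓝 (funk C x y)) :=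
  h.tendsto_funk hu tendsto_const_nhds hu' (fun _ => hy) hx hy

theorem tendsto_funk_right (h : IsBasedCone C φ b) {ι : Type*} {G : Filter ι} {v : ι → E}
    (hv : Tendsto v G (𝓝 y)) (hv' : ∀ i, v i ∈ C) (hx : x ∈ puncturedClosure C) (hy : y ∈ C) :
    Tendsto (fun i => funk C x (v i)) G (𝓝 (funk C x y)) :=
  h.tendsto_funk tendsto_const_nhds hv (fun _ => hx) hv' hx hy

/-- If the distance stayed below `s`, the limit would satisfy `exp s • x - y ∈ closure C`, and
adding `y ∈ C` would put `x` in `C`. -/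
theorem tendsto_funk_atTop (h : IsBasedCone C φ b) {ι : Type*} {G : Filter ι} {v : ι → E}
    (hv : Tendsto v G (𝓝 x)) (hv' : ∀ i, v i ∈ C) (hy : y ∈ C) (hx : x ∉ C) :
    Tendsto (fun i => funk C y (v i)) G atTop := by
  rw [tendsto_atTop]
  intro s
  have hnot : Real.exp s • x - y ∉ closure C := fun hmem => hx <| by
    have := h.cone.smul_mem _ (Real.exp_pos (-s)) _ (h.cone.add_mem hy hmem)
    rwa [add_sub_cancel, smul_smul, ← Real.exp_add, neg_add_cancel, Real.exp_zero,
      one_smul] at this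
  filter_upwards [((hv.const_smul (Real.exp s)).sub_const y).eventually
    (isClosed_closure.isOpen_compl.mem_nhds hnot)] with i hi
  by_contra hlt
  exact hi ((h.funk_le_iff (h.mem_punctured hy) (hv' i)).1 (not_le.1 hlt).le)

/-- On the cross section the Funk distance is non-negative. -/
theorem funk_nonneg (h : IsBasedCone C φ b) (hx : x ∈ puncturedClosure C) (hx1 : φ x = 1)
    (hy : y ∈ C) (hy1 : φ y = 1) : 0 ≤ funk C x y := by
  have hmem := h.exp_funk_smul_sub_mem hx hy
  by_cases h0 : Real.exp (funk C x y) • y - x = 0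
  · have := congrArg φ h0
    simp only [map_sub, map_smul, hx1, hy1, smul_eq_mul, mul_one, map_zero, sub_eq_zero,
      Real.exp_eq_one_iff] at this
    exact this.ge
  · have := h.positive _ hmem h0
    simp only [map_sub, map_smul, hx1, hy1, smul_eq_mul, mul_one, sub_pos, Real.one_lt_exp_iff]
      at this
    exact this.le

/-! ### Compactness of the section and of order intervals. -/

section FiniteDimensional

variable [FiniteDimensional ℝ E]

theorem exists_mul_norm_le (h : IsBasedCone C φ b) :
    ∃ m : ℝ, 0 < m ∧ ∀ x ∈ closure C, m * ‖x‖ ≤ φ x := by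
  have : ProperSpace E := FiniteDimensional.proper ℝ E
  have hcpt : IsCompact (closure C ∩ Metric.sphere (0 : E) 1) :=
    (isCompact_sphere (0 : E) 1).inter_left isClosed_closure
  have hb0 := (h.mem_punctured h.base_mem).2
  have hbn : 0 < ‖b‖ := norm_pos_iff.2 hb0
  obtain ⟨y, hy, hmin⟩ := hcpt.exists_isMinOn
    ⟨‖b‖⁻¹ • b, h.cone.smul_mem_closure (inv_pos.2 hbn) (subset_closure h.base_mem), by
      simp [norm_smul, hbn.ne']⟩ (LinearMap.continuous_of_finiteDimensional φ).continuousOn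
  have hy0 : y ≠ 0 := by
    rintro rfl
    simpa using hy.2
  refine ⟨φ y, h.positive y hy.1 hy0, fun x hx => ?_⟩
  by_cases hx0 : x = 0
  · simp [hx0]
  have hxn : 0 < ‖x‖ := norm_pos_iff.2 hx0
  have := hmin (show ‖x‖⁻¹ • x ∈ closure C ∩ Metric.sphere (0 : E) 1 from
    ⟨h.cone.smul_mem_closure (inv_pos.2 hxn) hx, by simp [norm_smul, hxn.ne']⟩)
  simp only [map_smul, smul_eq_mul, mem_ofPred] at this
  rwa [inv_mul_eq_div, le_div_iff₀ hxn] at this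

theorem isCompact_section (h : IsBasedCone C φ b) : IsCompact {x | x ∈ closure C ∧ φ x = 1} := by
  have : ProperSpace E := FiniteDimensional.proper ℝ E
  obtain ⟨m, hm, hle⟩ := h.exists_mul_norm_le
  have hφc : Continuous φ := LinearMap.continuous_of_finiteDimensional φ
  refine (isCompact_closedBall (0 : E) (1 / m)).of_isClosed_subset
    (isClosed_closure.inter (isClosed_eq hφc continuous_const)) fun x hx => ?_
  have := hle x hx.1
  rw [hx.2] at this
  rw [mem_closedBall_zero_iff, le_div_iff₀ hm]
  linarith

theorem closure_crossSection (h : IsBasedCone C φ b) (hx : x ∈ closure (crossSection C φ)) :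
    x ∈ puncturedClosure C ∧ φ x = 1 := by
  have hsub : crossSection C φ ⊆ {x | x ∈ closure C ∧ φ x = 1} := fun x hx =>
    ⟨subset_closure hx.1, hx.2⟩
  have := closure_minimal hsub h.isCompact_section.isClosed hx
  refine ⟨⟨this.1, ?_⟩, this.2⟩
  rintro rfl
  simpa using this.2

theorem sectionBoundary_notMem (h : IsBasedCone C φ b) (hx : x ∈ sectionBoundary C φ) :
    x ∉ C := fun hxC => hx.2 ⟨hxC, (h.closure_crossSection hx.1).2⟩

theorem isCompact_orderInterval (h : IsBasedCone C φ b) {a : E} (r : ℝ) :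
    IsCompact {z | Real.exp r • a - z ∈ closure C ∧ Real.exp r • z - a ∈ closure C ∧
      z ∈ closure C} := by
  have : ProperSpace E := FiniteDimensional.proper ℝ E
  obtain ⟨m, hm, hle⟩ := h.exists_mul_norm_le
  have c1 : Continuous fun z : E => Real.exp r • a - z := by fun_prop
  have c2 : Continuous fun z : E => Real.exp r • z - a := by fun_prop
  refine (isCompact_closedBall (0 : E) (Real.exp r * φ a / m)).of_isClosed_subset
    ((isClosed_closure.preimage c1).inter ((isClosed_closure.preimage c2).inter isClosed_closure))
    fun z hz => ?_
  have h1 := hle z hz.2.2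
  have h2 := hle _ hz.1
  simp only [map_sub, map_smul, smul_eq_mul] at h2
  rw [mem_closedBall_zero_iff, le_div_iff₀ hm]
  have := mul_nonneg hm.le (norm_nonneg (Real.exp r • a - z))
  linarith

/-- A set on which the Funk distances from and to a fixed point are bounded lies in a compact
subset of the cone. -/
theorem exists_isCompact (h : IsBasedCone C φ b) {a : E} (ha : a ∈ C) (r : ℝ) :
    ∃ Q, IsCompact Q ∧ Q ⊆ C ∧ ∀ z ∈ C, funk C z a ≤ r → funk C a z ≤ r → z ∈ Q := by
  refine ⟨_, h.isCompact_orderInterval (a := a) r, ?_, fun z hz h1 h2 =>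
    ⟨(h.funk_le_iff (h.mem_punctured hz) ha).1 h1, (h.funk_le_iff (h.mem_punctured ha) hz).1 h2,
      subset_closure hz⟩⟩
  rintro z ⟨-, hz, -⟩
  have := h.cone.smul_mem _ (Real.exp_pos (-r)) _ (h.cone.add_mem ha hz)
  rwa [add_sub_cancel, smul_smul, ← Real.exp_add, neg_add_cancel, Real.exp_zero, one_smul] at this

end FiniteDimensional

theorem hasFiniteNets (h : IsBasedCone C φ b) {Y : Type*} {d : Y → Y → ℝ} (i : Y → E)
    (hd : ∀ x y, d x y ≤ |funk C (i x) (i y)| + |funk C (i y) (i x)|)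
    (hB : ∀ B ∈ boundedSets d, ∃ Q, IsCompact Q ∧ Q ⊆ C ∧ Q ⊆ range i ∧ ∀ x ∈ B, i x ∈ Q) :
    HasFiniteNets d := by
  classical
  intro B hBd ε hε
  obtain ⟨Q, hQ, hQC, hQi, hBQ⟩ := hB B hBd
  obtain ⟨t, htQ, ht⟩ := hQ.elim_nhds_subcover
    (fun q => {z | |funk C z q| + |funk C q z| < ε}) (fun q hq => by
      have hqC := hQC hq
      have hsub : Tendsto (fun z : C => (z : E)) (comap (↑) (𝓝 q)) (𝓝 q) := tendsto_comap
      have h1 := h.tendsto_funk_left hsub (fun z => h.mem_punctured z.2) (h.mem_punctured hqC) hqC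
      have h2 := h.tendsto_funk_right hsub (fun z => z.2) (h.mem_punctured hqC) hqC
      have h3 := h1.abs.add h2.abs
      rw [h.funk_self hqC] at h3
      have h4 := h3.eventually (gt_mem_nhds (show |(0 : ℝ)| + |0| < ε by simpa using hε))
      rw [eventually_comap] at h4
      filter_upwards [h4, h.cone.isOpen.mem_nhds hqC] with z hz hzC
      exact hz ⟨z, hzC⟩ rfl)
  rcases isEmpty_or_nonempty Y with hY | hY
  · exact ⟨∅, fun x => isEmptyElim x⟩
  choose! g hg using fun q (hq : q ∈ Q) => hQi hq
  refine ⟨t.image g, fun x hx => ?_⟩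
  obtain ⟨q, hqt, hq⟩ := mem_iUnion₂.1 (ht (hBQ x hx))
  refine ⟨g q, Finset.mem_image_of_mem g hqt, ?_⟩
  have hq' : |funk C (i x) q| + |funk C q (i x)| < ε := hq
  have h1 := hd x (g q)
  have h2 := hd (g q) x
  rw [hg q (htQ q hqt)] at h1 h2
  constructor <;> linarith

end IsBasedCone

end ConeOrder

/-! ### Brackets with an extended-real parameter. -/

section Bracket

variable {X : Type*} {r f : X → ℝ}

theorem max_coe_add_min_sub_max (x y c : ℝ) :
    max ((x : EReal) + min (c : EReal) 0) ((y : EReal) - max (c : EReal) 0) =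
      ((max (x + min c 0) (y - max c 0) : ℝ) : EReal) := by
  rw [EReal.coe_strictMono.monotone.map_max, EReal.coe_add, EReal.coe_sub,
    EReal.coe_strictMono.monotone.map_max, EReal.coe_strictMono.monotone.map_min, EReal.coe_zero]

theorem bracket_coe (r f : X → ℝ) (c : ℝ) (z : X) :
    bracket r f c z = max (r z + min c 0) (f z - max c 0) := by
  rw [bracket, max_coe_add_min_sub_max, EReal.toReal_coe]

@[simp]
theorem bracket_top (r f : X → ℝ) : bracket r f ⊤ = r := by
  funext z
  simp [bracket]

@[simp]
theorem bracket_bot (r f : X → ℝ) : bracket r f ⊥ = f := by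
  funext z
  simp [bracket]

/-- This symmetry exchanges the reverse-Funk and Funk entries, so that statements about one follow
from the other. -/
theorem bracket_neg (r f : X → ℝ) (c : EReal) : bracket f r (-c) = bracket r f c := by
  induction c with
  | bot => simp
  | top => simp
  | coe c =>
    funext z
    rw [← EReal.coe_neg, bracket_coe, bracket_coe, max_comm]
    rw [show (0 : ℝ) = -0 by simp, max_neg_neg, min_neg_neg]
    simp [sub_eq_add_neg]

theorem tendsto_bracket {ι : Type*} {G : Filter ι} {u v : ι → X → ℝ} {e : ι → ℝ} {c : EReal}
    {z : X} (hu : Tendsto (fun i => u i z) G (𝓝 (r z))) (hv : Tendsto (fun i => v i z) G (𝓝 (f z)))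
    (he : Tendsto (fun i => (e i : EReal)) G (𝓝 c)) :
    Tendsto (fun i => bracket (u i) (v i) (e i) z) G (𝓝 (bracket r f c z)) := by
  have hu' := EReal.tendsto_coe.2 hu
  have hv' := EReal.tendsto_coe.2 hv
  have h1 : Tendsto (fun i => (u i z : EReal) + min (e i : EReal) 0) G
      (𝓝 ((r z : EReal) + min c 0)) :=
    (EReal.continuousAt_add (p := ((r z : EReal), min c 0)) (.inl (EReal.coe_ne_top _))
      (.inl (EReal.coe_ne_bot _))).tendsto.comp (hu'.prodMk_nhds (he.min tendsto_const_nhds))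
  have h2 : Tendsto (fun i => (v i z : EReal) - max (e i : EReal) 0) G
      (𝓝 ((f z : EReal) - max c 0)) :=
    (EReal.continuousAt_add (p := ((f z : EReal), -max c 0)) (.inl (EReal.coe_ne_top _))
      (.inl (EReal.coe_ne_bot _))).tendsto.comp
        (hv'.prodMk_nhds ((he.max tendsto_const_nhds).neg))
  refine (EReal.tendsto_toReal ?_ ?_).comp (h1.max h2)
  · induction c with
    | bot => simp
    | top => simp
    | coe c => rw [max_coe_add_min_sub_max]; exact EReal.coe_ne_top _
  · induction c with
    | bot => simp
    | top => simp
    | coe c => rw [max_coe_add_min_sub_max]; exact EReal.coe_ne_bot _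

end Bracket

/-! ### The three geometries and their behaviour under scaling. -/

namespace IsBasedCone

variable {E : Type*} [NormedAddCommGroup E] [NormedSpace ℝ E] {C : Set E} {φ : E →ₗ[ℝ] ℝ} {b : E}

theorem isAsymmDist_funkD (h : IsBasedCone C φ b) : IsAsymmDist (funkD C φ) :=
  ⟨fun x => h.funk_self x.2.1, fun x y z => h.funk_triangle (h.mem_punctured x.2.1) y.2.1 z.2.1⟩

theorem isAsymmDist_revFunkD (h : IsBasedCone C φ b) : IsAsymmDist (revFunkD C φ) :=
  ⟨fun x => h.funk_self x.2.1, fun x y z => (h.funk_triangle (h.mem_punctured z.2.1) y.2.1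
    x.2.1).trans_eq (add_comm _ _)⟩

theorem thompsonC_eq (h : IsBasedCone C φ b) (x y : C) :
    thompsonC C x y = max (funk C x y) (funk C y x) :=
  h.thompson_eq x.2 y.2

theorem isAsymmDist_thompsonC (h : IsBasedCone C φ b) : IsAsymmDist (thompsonC C) := by
  refine ⟨fun x => ?_, fun x y z => ?_⟩
  · rw [h.thompsonC_eq, max_self, h.funk_self x.2]
  · have h1 := h.funk_triangle (h.mem_punctured x.2) y.2 z.2
    have h2 := h.funk_triangle (h.mem_punctured z.2) y.2 x.2
    simp only [h.thompsonC_eq]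
    refine max_le (h1.trans (add_le_add (le_max_left _ _) (le_max_left _ _))) ?_
    rw [add_comm] at h2
    exact h2.trans (add_le_add (le_max_right _ _) (le_max_right _ _))

section FiniteDimensional

variable [FiniteDimensional ℝ E]

theorem hasFiniteNets_thompsonC (h : IsBasedCone C φ b) : HasFiniteNets (thompsonC C) := by
  refine h.hasFiniteNets (Y := C) (↑) (fun x y => ?_) fun B hB => ?_
  · rw [h.thompsonC_eq]
    have h1 := abs_nonneg (funk C (x : E) y)
    have h2 := abs_nonneg (funk C (y : E) x)
    have h3 := le_abs_self (funk C (x : E) y)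
    have h4 := le_abs_self (funk C (y : E) x)
    exact max_le (by linarith) (by linarith)
  · obtain ⟨ρ, hρ⟩ := hB
    rcases B.eq_empty_or_nonempty with rfl | ⟨a, ha⟩
    · exact ⟨∅, isCompact_empty, empty_subset _, empty_subset _, fun x hx => hx.elim⟩
    obtain ⟨Q, hQ, hQC, hQm⟩ := h.exists_isCompact a.2 (ρ / 2)
    refine ⟨Q, hQ, hQC, by simpa using hQC, fun x hx => ?_⟩
    have h1 := hρ x hx a ha
    rw [h.thompsonC_eq, h.thompsonC_eq, max_comm (funk C (a : E) x)] at h1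
    have h2 := le_max_left (funk C (x : E) a) (funk C a x)
    have h3 := le_max_right (funk C (x : E) a) (funk C a x)
    exact hQm x x.2 (by linarith) (by linarith)

theorem hasFiniteNets_crossSection (h : IsBasedCone C φ b)
    {d : crossSection C φ → crossSection C φ → ℝ}
    (hd : ∀ x y : crossSection C φ, d x y ≤ |funk C (x : E) y| + |funk C (y : E) x|)
    (hd' : ∀ x y : crossSection C φ, d x y + d y x = funk C (x : E) y + funk C (y : E) x) :
    HasFiniteNets d := by
  refine h.hasFiniteNets (Y := crossSection C φ) (↑) hd fun B hB => ?_
  obtain ⟨ρ, hρ⟩ := hB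
  rcases B.eq_empty_or_nonempty with rfl | ⟨a, ha⟩
  · exact ⟨∅, isCompact_empty, empty_subset _, empty_subset _, fun x hx => hx.elim⟩
  obtain ⟨Q, hQ, hQC, hQm⟩ := h.exists_isCompact a.2.1 ρ
  have hφc : Continuous φ := LinearMap.continuous_of_finiteDimensional φ
  refine ⟨Q ∩ {x | φ x = 1}, hQ.inter_right (isClosed_eq hφc continuous_const),
    inter_subset_left.trans hQC, fun x hx => ⟨⟨x, hQC hx.1, hx.2⟩, rfl⟩, fun x hx => ⟨?_, x.2.2⟩⟩
  have h1 := hρ x hx a ha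
  rw [hd'] at h1
  have h2 := h.funk_nonneg (h.mem_punctured x.2.1) x.2.2 a.2.1 a.2.2
  have h3 := h.funk_nonneg (h.mem_punctured a.2.1) a.2.2 x.2.1 x.2.2
  exact hQm x x.2.1 (by linarith) (by linarith)

theorem hasFiniteNets_funkD (h : IsBasedCone C φ b) : HasFiniteNets (funkD C φ) :=
  h.hasFiniteNets_crossSection (fun _ _ => (le_abs_self _).trans (le_add_of_nonneg_right
    (abs_nonneg _))) fun _ _ => rfl

theorem hasFiniteNets_revFunkD (h : IsBasedCone C φ b) : HasFiniteNets (revFunkD C φ) :=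
  h.hasFiniteNets_crossSection (fun _ _ => (le_abs_self _).trans (le_add_of_nonneg_left
    (abs_nonneg _))) fun _ _ => add_comm _ _

end FiniteDimensional

/-- Multiplication by `exp s` on the cone. -/
noncomputable def scale (h : IsBasedCone C φ b) (s : ℝ) (z : C) : C :=
  ⟨Real.exp s • (z : E), h.cone.smul_mem _ (Real.exp_pos s) _ z.2⟩

theorem funk_scale_left (h : IsBasedCone C φ b) (s : ℝ) (z : C) {y : E} (hy : y ∈ C) :
    funk C (h.scale s z) y = funk C z y + s := by
  rw [scale, h.funk_smul_left (h.mem_punctured z.2) hy (Real.exp_pos s), Real.log_exp]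

theorem funk_scale_right (h : IsBasedCone C φ b) (s : ℝ) (z : C) {x : E}
    (hx : x ∈ puncturedClosure C) : funk C x (h.scale s z) = funk C x z - s := by
  rw [scale, h.funk_smul_right hx z.2 (Real.exp_pos s), Real.log_exp]

theorem rC_apply (x : E) (z : C) : rC C b x z = funk C x z - funk C x b := rfl

theorem fC_apply (h : IsBasedCone C φ b) {x : E} (hx : x ∈ C) (z : C) :
    fC C b x z = funk C z x - funk C b x :=
  h.fFun_eq hx z.2

theorem rC_scale (h : IsBasedCone C φ b) {x : E} (hx : x ∈ puncturedClosure C) (s : ℝ) (z : C) :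
    rC C b x (h.scale s z) = rC C b x z - s := by
  rw [rC_apply, rC_apply, h.funk_scale_right s z hx]
  ring

theorem fC_scale (h : IsBasedCone C φ b) {x : E} (hx : x ∈ C) (s : ℝ) (z : C) :
    fC C b x (h.scale s z) = fC C b x z + s := by
  rw [h.fC_apply hx, h.fC_apply hx, h.funk_scale_left s z hx]
  ring

theorem rC_scale_point (h : IsBasedCone C φ b) (s : ℝ) (x : C) :
    rC C b (h.scale s x) = rC C b x := by
  funext z
  rw [rC_apply, rC_apply, h.funk_scale_left s x z.2, h.funk_scale_left s x h.base_mem]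
  ring

theorem fC_scale_point (h : IsBasedCone C φ b) (s : ℝ) (x : C) :
    fC C b (h.scale s x) = fC C b x := by
  funext z
  rw [h.fC_apply (h.scale s x).2, h.fC_apply x.2, h.funk_scale_right s x (h.mem_punctured z.2),
    h.funk_scale_right s x (h.mem_punctured h.base_mem)]
  ring

theorem isNonexpansive_rC (h : IsBasedCone C φ b) {x : E} (hx : x ∈ puncturedClosure C) :
    IsNonexpansive (thompsonC C) (rC C b x) := fun p q => by
  have := h.funk_triangle hx q.2 p.2
  rw [h.thompsonC_eq, rC_apply, rC_apply]
  exact le_max_of_le_right (by linarith)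

theorem isNonexpansive_fC (h : IsBasedCone C φ b) {x : E} (hx : x ∈ C) :
    IsNonexpansive (thompsonC C) (fC C b x) := fun p q => by
  have := h.funk_triangle (h.mem_punctured p.2) q.2 hx
  rw [h.thompsonC_eq, h.fC_apply hx, h.fC_apply hx]
  exact le_max_of_le_left (by linarith)

/-- The Thompson functions `ψ_z` in terms of the Funk and reverse-Funk ones. -/
theorem distFun_thompsonC (h : IsBasedCone C φ b) (z : C) :
    distFun (thompsonC C) ⟨b, h.base_mem⟩ z =
      bracket (rC C b z) (fC C b z) ((funk C z b - funk C b z : ℝ) : EReal) := by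
  funext p
  rw [bracket_coe, distFun, h.thompsonC_eq, h.thompsonC_eq, rC_apply, h.fC_apply z.2]
  simp only
  rcases le_total (funk C b z) (funk C z b) with hle | hle
  · rw [max_eq_right hle, min_eq_right (sub_nonneg.2 hle), max_eq_left (sub_nonneg.2 hle),
      max_comm, ← max_sub_sub_right]
    congr 1 <;> ring
  · rw [max_eq_left hle, min_eq_left (sub_nonpos.2 hle), max_eq_right (sub_nonpos.2 hle),
      max_comm, ← max_sub_sub_right]
    congr 1 <;> ring

theorem tendsto_distFun_thompsonC (h : IsBasedCone C φ b) {ι : Type*} {G : Filter ι} {u : ι → C}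
    {r f : C → ℝ} {c : EReal} (hr : ∀ p, Tendsto (fun i => rC C b (u i) p) G (𝓝 (r p)))
    (hf : ∀ p, Tendsto (fun i => fC C b (u i) p) G (𝓝 (f p)))
    (hc : Tendsto (fun i => ((funk C (u i) b - funk C b (u i) : ℝ) : EReal)) G (𝓝 c)) (p : C) :
    Tendsto (fun i => distFun (thompsonC C) ⟨b, h.base_mem⟩ (u i) p) G
      (𝓝 (bracket r f c p)) := by
  simp only [h.distFun_thompsonC]
  exact tendsto_bracket (hr p) (hf p) hc

/-- If both the reverse-Funk and the Funk detour cost vanish along a family, so does the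
Thompson one of every bracket, along suitable multiples of the family. -/
theorem hasZeroDetour_bracket (h : IsBasedCone C φ b) {ι : Type*} {G : Filter ι} [NeBot G]
    {u : ι → C} {r f : C → ℝ} (hrs : ∀ s z, r (h.scale s z) = r z - s)
    (hfs : ∀ s z, f (h.scale s z) = f z + s)
    (hr : ∀ p, Tendsto (fun i => rC C b (u i) p) G (𝓝 (r p)))
    (hf : ∀ p, Tendsto (fun i => fC C b (u i) p) G (𝓝 (f p)))
    (hr0 : Tendsto (fun i => funk C (u i) b + r (u i)) G (𝓝 0))
    (hf0 : Tendsto (fun i => funk C b (u i) + f (u i)) G (𝓝 0)) (c : EReal) :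
    HasZeroDetour (thompsonC C) ⟨b, h.base_mem⟩ (bracket r f c) := by
  -- The factor makes `F(v, b) - F(b, v)` equal to the second coordinate. The sums `F(v, b) + r(v)`
  -- and `F(b, v) + f(v)` are scale-invariant, so they keep their limit zero.
  let v : ι × ℝ → C := fun q => h.scale ((q.2 - (funk C (u q.1) b - funk C b (u q.1))) / 2) (u q.1)
  have hvb : ∀ q, funk C (v q) b - funk C b (v q) = q.2 := fun q => by
    rw [h.funk_scale_left _ _ h.base_mem, h.funk_scale_right _ _ (h.mem_punctured h.base_mem)]
    ring
  have hvr : ∀ q, funk C (v q) b + r (v q) = funk C (u q.1) b + r (u q.1) := fun q => by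
    rw [h.funk_scale_left _ _ h.base_mem, hrs]
    ring
  have hvf : ∀ q, funk C b (v q) + f (v q) = funk C b (u q.1) + f (u q.1) := fun q => by
    rw [h.funk_scale_right _ _ (h.mem_punctured h.base_mem), hfs]
    ring
  have key : ∀ {L : Filter ℝ} [NeBot L], Tendsto (fun t : ℝ => (t : EReal)) L (𝓝 c) →
      Tendsto (fun q : ι × ℝ => thompsonC C ⟨b, h.base_mem⟩ (v q) + bracket r f c (v q))
        (G ×ˢ L) (𝓝 0) →
      HasZeroDetour (thompsonC C) ⟨b, h.base_mem⟩ (bracket r f c) := by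
    intro L _ hL h0
    refine HasZeroDetour.of_tendsto (G := G ×ˢ L) (u := v)
      (h.tendsto_distFun_thompsonC ?_ ?_ ?_) h0
    · intro p
      simp only [v, h.rC_scale_point]
      exact (hr p).comp tendsto_fst
    · intro p
      simp only [v, h.fC_scale_point]
      exact (hf p).comp tendsto_fst
    · simp only [hvb]
      exact hL.comp tendsto_snd
  induction c with
  | bot =>
    refine key (L := atBot) EReal.tendsto_coe_atBot ?_
    rw [bracket_bot]
    refine (hf0.comp tendsto_fst).congr' ?_
    filter_upwards [tendsto_snd.eventually (eventually_le_atBot (0 : ℝ))] with q hq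
    have := hvb q
    rw [Function.comp_apply, ← hvf, h.thompsonC_eq, max_eq_left (by dsimp only; linarith)]
  | top =>
    refine key (L := atTop) EReal.tendsto_coe_atTop ?_
    rw [bracket_top]
    refine (hr0.comp tendsto_fst).congr' ?_
    filter_upwards [tendsto_snd.eventually (eventually_ge_atTop (0 : ℝ))] with q hq
    have := hvb q
    rw [Function.comp_apply, ← hvr, h.thompsonC_eq, max_eq_right (by dsimp only; linarith)]
  | coe c =>
    -- For finite `c` the parameter is exactly `c` along the family, and `d_T(b, v)` plus the
    -- bracket is the maximum of the two invariant sums.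
    refine key (L := pure c) ((tendsto_pure_nhds (fun t : ℝ => (t : EReal)) c)) ?_
    have hmax := (hr0.max hf0).comp (tendsto_fst (f := G) (g := pure c))
    rw [max_self] at hmax
    refine hmax.congr' ?_
    filter_upwards [tendsto_snd.eventually (eventually_pure.2 (rfl : c = c))] with q hq
    have := hvb q
    rw [Function.comp_apply, ← hvr, ← hvf, h.thompsonC_eq, bracket_coe]
    dsimp only
    have hq' : c = q.2 := hq
    rcases le_total c 0 with hc | hc
    · rw [min_eq_left hc, max_eq_right hc,
        max_eq_left (show funk C (v q) b ≤ funk C b (v q) by linarith), ← max_add_add_left]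
      congr 1 <;> linarith
    · rw [min_eq_right hc, max_eq_left hc,
        max_eq_right (show funk C b (v q) ≤ funk C (v q) b by linarith), ← max_add_add_left]
      congr 1 <;> linarith

end IsBasedCone

/-- `η(z) - ξ(z)` is the difference of the two sums, hence unbounded above. -/
theorem detourCost_eq_top {X : Type*} {d : X → X → ℝ} {b : X} {ξ η : X → ℝ} (hd : IsAsymmDist d)
    (hη : IsNonexpansive d η) {G : Filter X} [NeBot G]
    (hξ : Tendsto (fun z => d b z + ξ z) G (𝓝 0))
    (htop : Tendsto (fun z => d b z + η z) G atTop) : detourCost d b ξ η = ⊤ := by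
  rw [EReal.eq_top_iff_forall_lt]
  intro K
  obtain ⟨z, h1, h2⟩ := ((hξ.eventually (gt_mem_nhds one_pos)).and
    (htop.eventually_ge_atTop (K + 2))).exists
  refine lt_of_lt_of_le ?_ (sub_le_detourCost hd hη z)
  rw [EReal.coe_lt_coe_iff]
  linarith

theorem sub_le_bracket {X : Type*} (r f : X → ℝ) {c : EReal} (hc : c ≠ ⊤) (z : X) :
    f z - (max c 0).toReal ≤ bracket r f c z := by
  induction c with
  | bot => simp
  | top => exact absurd rfl hc
  | coe c =>
    rw [bracket_coe, ← EReal.coe_zero, ← EReal.coe_strictMono.monotone.map_max, EReal.toReal_coe]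
    exact le_max_right _ _

/-! ### Homogeneous extension and Funk limits at the boundary. -/

namespace IsBasedCone

variable {E : Type*} [NormedAddCommGroup E] [NormedSpace ℝ E] {C : Set E} {φ : E →ₗ[ℝ] ℝ} {b : E}
variable {x : E}

/-- A point of the cross section as a point of the cone. -/
def ofSection (p : crossSection C φ) : C := ⟨p, p.2.1⟩

/-- The projection of the cone to the cross section. -/
noncomputable def proj (h : IsBasedCone C φ b) (z : C) : crossSection C φ :=
  toSection h.cone h.positive h.base z

/-- The extension of a function on the cross section to the cone. -/
noncomputable def ext (h : IsBasedCone C φ b) (f : crossSection C φ → ℝ) : C → ℝ :=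
  extendToCone h.cone h.positive h.base f

theorem map_pos (h : IsBasedCone C φ b) (z : C) : 0 < φ z :=
  pos_of_mem h.cone h.positive h.base z.2

theorem scale_log_ofSection_proj (h : IsBasedCone C φ b) (z : C) :
    h.scale (Real.log (φ z)) (ofSection (h.proj z)) = z := by
  apply Subtype.ext
  change Real.exp (Real.log (φ z)) • (φ z)⁻¹ • (z : E) = z
  rw [Real.exp_log (h.map_pos z), smul_inv_smul₀ (h.map_pos z).ne']

theorem proj_scale (h : IsBasedCone C φ b) (s : ℝ) (z : C) :
    h.proj (h.scale s z) = h.proj z := by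
  apply Subtype.ext
  change (φ (Real.exp s • (z : E)))⁻¹ • Real.exp s • (z : E) = (φ z)⁻¹ • (z : E)
  rw [map_smul, smul_eq_mul, mul_inv, smul_smul, mul_right_comm,
    inv_mul_cancel₀ (Real.exp_pos s).ne', one_mul]

theorem proj_ofSection (h : IsBasedCone C φ b) (p : crossSection C φ) :
    h.proj (ofSection p) = p := by
  apply Subtype.ext
  change (φ (p : E))⁻¹ • (p : E) = p
  rw [p.2.2, inv_one, one_smul]

theorem ext_apply (h : IsBasedCone C φ b) (f : crossSection C φ → ℝ) (z : C) :
    h.ext f z = f (h.proj z) + Real.log (φ z) := rfl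

theorem ext_scale (h : IsBasedCone C φ b) (f : crossSection C φ → ℝ) (s : ℝ) (z : C) :
    h.ext f (h.scale s z) = h.ext f z + s := by
  rw [ext_apply, ext_apply, proj_scale]
  change _ + Real.log (φ (Real.exp s • (z : E))) = _
  rw [map_smul, smul_eq_mul, Real.log_mul (Real.exp_pos s).ne' (h.map_pos z).ne', Real.log_exp]
  ring

theorem ext_ofSection (h : IsBasedCone C φ b) (f : crossSection C φ → ℝ) (p : crossSection C φ) :
    h.ext f (ofSection p) = f p := by
  rw [ext_apply, proj_ofSection]
  change f p + Real.log (φ (p : E)) = f p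
  rw [p.2.2, Real.log_one, add_zero]

/-- A degree-zero homogeneous function on the cone depends only on the projection. -/
theorem apply_proj (h : IsBasedCone C φ b) {α : Type*} {g : C → α}
    (hg : ∀ s z, g (h.scale s z) = g z) (z : C) : g (ofSection (h.proj z)) = g z := by
  conv_rhs => rw [← h.scale_log_ofSection_proj z, hg]

theorem rC_proj (h : IsBasedCone C φ b) (z : C) : rC C b (h.proj z) = rC C b z :=
  h.apply_proj (g := fun z => rC C b z) h.rC_scale_point z

theorem fC_proj (h : IsBasedCone C φ b) (z : C) : fC C b (h.proj z) = fC C b z :=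
  h.apply_proj (g := fun z => fC C b z) h.fC_scale_point z

theorem funk_add_rC_proj (h : IsBasedCone C φ b) (hx : x ∈ puncturedClosure C) (z : C) :
    funk C (h.proj z) b + rC C b x (ofSection (h.proj z)) = funk C z b + rC C b x z :=
  h.apply_proj (g := fun z => funk C z b + rC C b x z) (fun s z => by
    rw [h.funk_scale_left s z h.base_mem, h.rC_scale hx]; ring) z

theorem funk_add_proj (h : IsBasedCone C φ b) {f : C → ℝ}
    (hf : ∀ s z, f (h.scale s z) = f z + s) (z : C) :
    funk C b (h.proj z) + f (ofSection (h.proj z)) = funk C b z + f z :=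
  h.apply_proj (g := fun z : C => funk C b z + f z) (fun s z => by
    rw [h.funk_scale_right s z (h.mem_punctured h.base_mem), hf]; ring) z

theorem distFun_funkD (h : IsBasedCone C φ b) (z p : crossSection C φ) :
    distFun (funkD C φ) ⟨b, h.base⟩ z p = fC C b z (ofSection p) := by
  rw [h.fC_apply z.2.1]
  rfl

theorem tendsto_fC_ext (h : IsBasedCone C φ b) {ι : Type*} {G : Filter ι} {u : ι → C}
    {f : crossSection C φ → ℝ}
    (hf : ∀ p : crossSection C φ, Tendsto (fun i => fC C b (u i) (ofSection p)) G (𝓝 (f p)))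
    (z : C) : Tendsto (fun i => fC C b (u i) z) G (𝓝 (h.ext f z)) := by
  have := (hf (h.proj z)).add_const (Real.log (φ z))
  rw [h.ext_apply]
  simpa only [← h.fC_scale (u _).2, h.scale_log_ofSection_proj] using this

theorem tendsto_rC (h : IsBasedCone C φ b) {ι : Type*} {G : Filter ι} {u : ι → C}
    (hx : x ∈ puncturedClosure C) (hu : Tendsto (fun i => (u i : E)) G (𝓝 x)) (p : C) :
    Tendsto (fun i => rC C b (u i) p) G (𝓝 (rC C b x p)) :=
  (h.tendsto_funk_left hu (fun i => h.mem_punctured (u i).2) hx p.2).sub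
    (h.tendsto_funk_left hu (fun i => h.mem_punctured (u i).2) hx h.base_mem)

theorem tendsto_fC (h : IsBasedCone C φ b) {ι : Type*} {G : Filter ι} {u : ι → C}
    (hx : x ∈ C) (hu : Tendsto (fun i => (u i : E)) G (𝓝 x)) (p : C) :
    Tendsto (fun i => fC C b (u i) p) G (𝓝 (fC C b x p)) := by
  simp only [h.fC_apply hx, h.fC_apply (u _).2]
  exact (h.tendsto_funk_right hu (fun i => (u i).2) (h.mem_punctured p.2) hx).sub
    (h.tendsto_funk_right hu (fun i => (u i).2) (h.mem_punctured h.base_mem) hx)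

theorem sub_le_funk_of_tendsto (h : IsBasedCone C φ b) {ι : Type*} {G : Filter ι} [NeBot G]
    {u : ι → C} {g : C → ℝ} (hg : ∀ p, Tendsto (fun i => fC C b (u i) p) G (𝓝 (g p))) (p q : C) :
    g p - g q ≤ funk C p q := by
  refine le_of_tendsto ((hg p).sub (hg q)) (Eventually.of_forall fun i => ?_)
  have := h.funk_triangle (h.mem_punctured p.2) q.2 (u i).2
  rw [h.fC_apply (u i).2, h.fC_apply (u i).2]
  linarith

theorem apply_base_of_tendsto (h : IsBasedCone C φ b) {ι : Type*} {G : Filter ι} [NeBot G]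
    {u : ι → C} {g : C → ℝ} (hg : ∀ p, Tendsto (fun i => fC C b (u i) p) G (𝓝 (g p))) :
    g ⟨b, h.base_mem⟩ = 0 := by
  refine tendsto_nhds_unique (hg _) ?_
  simp [h.fC_apply (u _).2]

theorem funk_add_nonneg_of_tendsto (h : IsBasedCone C φ b) {ι : Type*} {G : Filter ι} [NeBot G]
    {u : ι → C} {g : C → ℝ} (hg : ∀ p, Tendsto (fun i => fC C b (u i) p) G (𝓝 (g p))) (p : C) :
    0 ≤ funk C b p + g p := by
  have h1 := h.sub_le_funk_of_tendsto hg ⟨b, h.base_mem⟩ p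
  rw [h.apply_base_of_tendsto hg] at h1
  dsimp only at h1
  linarith

/-- The exponential of a Funk horofunction at `x` is sublinear and vanishes at `x`. -/
theorem apply_le_of_eq_add_smul (h : IsBasedCone C φ b) {ι : Type*} {G : Filter ι} [NeBot G]
    {u : ι → C} {g : C → ℝ} (hg : ∀ p, Tendsto (fun i => fC C b (u i) p) G (𝓝 (g p)))
    (hu : Tendsto (fun i => (u i : E)) G (𝓝 x)) (hx : x ∉ C) {w γ : C} {ε : ℝ} (hε : 0 < ε)
    (hw : (w : E) = x + ε • (γ : E)) : g w ≤ g γ + Real.log ε := by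
  refine le_of_forall_gt fun t ht => ?_
  obtain ⟨t₂, ht₂, ht₂'⟩ := exists_between ht
  obtain ⟨t₁, ht₁, ht₁'⟩ := exists_between ht₂
  refine lt_of_le_of_lt ?_ ht₂'
  have hF := h.tendsto_funk_atTop hu (fun i => (u i).2) h.base_mem hx
  -- With `exp t₂ = exp t₁ + 2k`, one `k` pays for `-k b` and the other for `-u i`, the latter once
  -- `k exp F(b, u i) ≥ 1`. Then `k b + (u i - x) ∈ C` supplies `-x`.
  set k : ℝ := (Real.exp t₂ - Real.exp t₁) / 2 with hk
  have hk0 : 0 < k := half_pos (sub_pos.2 (Real.exp_lt_exp.2 ht₁'))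
  have e1 : ∀ᶠ i in G, 1 ≤ k * Real.exp (funk C b (u i)) :=
    (((Real.tendsto_exp_atTop.comp hF).const_mul_atTop hk0).eventually_ge_atTop 1)
  have e2 : ∀ᶠ i in G, k • b + ((u i : E) - x) ∈ C := by
    have : Tendsto (fun i => k • b + ((u i : E) - x)) G (𝓝 (k • b)) := by
      simpa using (tendsto_const_nhds (x := k • b)).add (hu.sub_const x)
    exact this.eventually (h.cone.isOpen.mem_nhds (h.cone.smul_mem k hk0 b h.base_mem))
  have e3 := (hg γ).eventually (gt_mem_nhds (lt_sub_iff_add_lt.2 ht₁))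
  refine le_of_tendsto (hg w) ?_
  filter_upwards [e1, e2, e3] with i h1 h2 h3
  have hbp := h.mem_punctured h.base_mem
  rw [h.fC_apply (u i).2] at h3 ⊢
  rw [sub_le_iff_le_add, h.funk_le_iff (h.mem_punctured w.2) (u i).2, Real.exp_add, hw]
  have m1 : funk C (ε • (γ : E)) (u i) ≤ t₁ + funk C b (u i) := by
    rw [h.funk_smul_left (h.mem_punctured γ.2) (u i).2 hε]
    linarith
  rw [h.funk_le_iff (h.smul_mem_punctured (h.mem_punctured γ.2) hε) (u i).2, Real.exp_add] at m1
  have m2 := h.cone.smul_mem_closure hk0 (h.exp_funk_smul_sub_mem hbp (u i).2)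
  have m3 : (k * Real.exp (funk C b (u i)) - 1) • (u i : E) ∈ closure C := by
    rcases h1.eq_or_lt with h1 | h1
    · rw [← h1, sub_self, zero_smul]
      exact h.cone.zero_mem_closure
    · exact h.cone.smul_mem_closure (sub_pos.2 h1) (subset_closure (u i).2)
  have hk2 : Real.exp t₂ = Real.exp t₁ + 2 * k := by rw [hk]; ring
  rw [hk2]
  convert h.cone.add_mem_closure (h.cone.add_mem_closure m1 m2)
    (h.cone.add_mem_closure m3 (subset_closure h2)) using 1
  module

/-- The triangle inequality confines the values at `p` to the compact interval `[-F(b, p), F(p,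
b)]`. -/
theorem exists_tendsto_fC (h : IsBasedCone C φ b) {ι : Type*} (U : Ultrafilter ι) (u : ι → C) :
    ∃ f : C → ℝ, ∀ p, Tendsto (fun i => fC C b (u i) p) U (𝓝 (f p)) := by
  have : ∀ p : C, ∃ y : ℝ, Tendsto (fun i => fC C b (u i) p) U (𝓝 y) := by
    intro p
    obtain ⟨y, -, hy⟩ := (isCompact_Icc (a := -funk C b p) (b := funk C p b)).ultrafilter_le_nhds
      (U.map fun i => fC C b (u i) p) (by
        rw [Ultrafilter.coe_map, le_principal_iff, mem_map]
        refine univ_mem' fun i => ?_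
        have h1 := h.funk_triangle (h.mem_punctured p.2) h.base_mem (u i).2
        have h2 := h.funk_triangle (h.mem_punctured h.base_mem) p.2 (u i).2
        rw [mem_preimage, h.fC_apply (u i).2, mem_Icc]
        constructor <;> linarith)
    exact ⟨y, hy⟩
  choose f hf using this
  exact ⟨f, hf⟩

theorem hasZeroDetour_bracket_interior (h : IsBasedCone C φ b) (hx : x ∈ C) (c : EReal) :
    HasZeroDetour (thompsonC C) ⟨b, h.base_mem⟩ (bracket (rC C b x) (fC C b x) c) := by
  refine h.hasZeroDetour_bracket (G := pure ()) (u := fun _ => ⟨x, hx⟩)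
    (h.rC_scale (h.mem_punctured hx)) (h.fC_scale hx) (fun p => tendsto_const_nhds)
    (fun p => tendsto_const_nhds) ?_ ?_ c
  · simp [rC_apply, h.funk_self hx]
  · simp [h.fC_apply hx, h.funk_self hx]

theorem hasZeroDetour_rC (h : IsBasedCone C φ b) (hx : x ∈ C) :
    HasZeroDetour (thompsonC C) ⟨b, h.base_mem⟩ (rC C b x) := by
  simpa using h.hasZeroDetour_bracket_interior hx ⊤

theorem hasZeroDetour_fC (h : IsBasedCone C φ b) (hx : x ∈ C) :
    HasZeroDetour (thompsonC C) ⟨b, h.base_mem⟩ (fC C b x) := by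
  simpa using h.hasZeroDetour_bracket_interior hx ⊥

/-! ### Zero detour at boundary points. -/

section FiniteDimensional

variable [FiniteDimensional ℝ E]

/-- The three convergences define a countably generated filter, from which a single sequence is
extracted; it serves both as almost-geodesic and as the witness for `B(x)`. -/
theorem mem_funkBusemannAt (h : IsBasedCone C φ b) (hx : x ∈ sectionBoundary C φ)
    {G : Filter (crossSection C φ)} [NeBot G] {f : crossSection C φ → ℝ}
    (hG : Tendsto (fun z : crossSection C φ => (z : E)) G (𝓝 x))
    (hf : ∀ p, Tendsto (fun z => distFun (funkD C φ) ⟨b, h.base⟩ z p) G (𝓝 (f p)))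
    (h0 : Tendsto (fun z : crossSection C φ => funkD C φ ⟨b, h.base⟩ z + f z) G (𝓝 0)) :
    f ∈ funkBusemannAt C φ ⟨b, h.base⟩ x := by
  have hd := h.isAsymmDist_funkD
  have hn := h.hasFiniteNets_funkD
  have hf' := (tendsto_toFunSpace_distFun_iff hd hn (u := fun z => z)).2 hf
  have := isCountablyGenerated_nhds_toFunSpace hd ⟨b, h.base⟩ f
  let L := comap (fun z => toFunSpace (funkD C φ) (distFun (funkD C φ) ⟨b, h.base⟩ z))
    (𝓝 (toFunSpace (funkD C φ) f)) ⊓ (comap (fun z : crossSection C φ => (z : E)) (𝓝 x) ⊓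
      comap (fun z : crossSection C φ => funkD C φ ⟨b, h.base⟩ z + f z) (𝓝 0))
  have hGL : G ≤ L := le_inf hf'.le_comap (le_inf hG.le_comap h0.le_comap)
  have : NeBot L := neBot_of_le hGL
  obtain ⟨u, hu⟩ := exists_seq_tendsto L
  rw [tendsto_inf, tendsto_inf, tendsto_comap_iff, tendsto_comap_iff, tendsto_comap_iff] at hu
  obtain ⟨h1, h2, h3⟩ := hu
  refine ⟨isBusemann_of_seq hd hn (fun p q => h.funk_nonneg (h.mem_punctured p.2.1) p.2.2 q.2.1
    q.2.2) ((tendsto_toFunSpace_distFun_iff hd hn).1 h1) h3 ?_, u, h2, h1⟩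
  exact h.tendsto_funk_atTop h2 (fun n => (u n).2.1) h.base_mem (h.sectionBoundary_notMem hx)

/-- The segment from `b` to `x`, sampled so that `F(b, z n) = n`, satisfies `F(z m, z n) ≤ n - m`.
An ultrafilter limit `f` of it then has `F(b, z m) + f(z m) = 0` for all `m`. -/
theorem funkBusemannAt_nonempty (h : IsBasedCone C φ b) (hx : x ∈ sectionBoundary C φ) :
    (funkBusemannAt C φ ⟨b, h.base⟩ x).Nonempty := by
  obtain ⟨hxK, hx1⟩ := h.closure_crossSection hx.1
  have hxC := h.sectionBoundary_notMem hx
  have hsmul : ∀ {t : ℝ}, 0 ≤ t → t • x ∈ closure C := fun {t} ht => by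
    rcases ht.eq_or_lt with rfl | ht
    · rw [zero_smul]; exact h.cone.zero_mem_closure
    · exact h.cone.smul_mem_closure ht hxK.1
  have hexp : ∀ n : ℕ, Real.exp (-n) ≤ 1 := fun n => by
    rw [Real.exp_le_one_iff]; simp
  let z : ℕ → crossSection C φ := fun n => ⟨Real.exp (-n) • b + (1 - Real.exp (-n)) • x,
    h.cone.add_mem (h.cone.smul_mem _ (Real.exp_pos _) _ h.base_mem)
      (hsmul (sub_nonneg.2 (hexp n))), by
    rw [map_add, map_smul, map_smul, h.base.2, hx1]; simp⟩
  have hz : ∀ n, (z n : E) = Real.exp (-n) • b + (1 - Real.exp (-n)) • x := fun n => rfl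
  have hbp := h.mem_punctured h.base_mem
  have hle : ∀ n, funk C b (z n) ≤ n := fun n => by
    rw [h.funk_le_iff hbp (z n).2.1, hz]
    convert hsmul (t := Real.exp n - 1) (by simp) using 1
    have : Real.exp (n : ℝ) * Real.exp (-n) = 1 := by rw [← Real.exp_add]; simp
    rw [smul_add, smul_smul, smul_smul, mul_sub, this]
    module
  have hge : ∀ n, n ≤ funk C b (z n) := fun n => by
    by_contra hlt
    obtain ⟨s, hs1, hs2⟩ := exists_between (not_le.1 hlt)
    have hmem := (h.funk_le_iff hbp (z n).2.1).1 hs1.le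
    have hs : Real.exp s * Real.exp (-n) < 1 := by
      rw [← Real.exp_add, Real.exp_lt_one_iff]; linarith
    have hC := h.cone.add_mem (h.cone.smul_mem _ (sub_pos.2 hs) _ h.base_mem) hmem
    have heq : (1 - Real.exp s * Real.exp (-n)) • b + (Real.exp s • (z n : E) - b) =
        (Real.exp s * (1 - Real.exp (-n))) • x := by
      rw [hz]; module
    rw [heq] at hC
    have ht : 0 ≤ Real.exp s * (1 - Real.exp (-n)) :=
      mul_nonneg (Real.exp_pos s).le (sub_nonneg.2 (hexp n))
    rcases ht.eq_or_lt with ht | ht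
    · rw [← ht, zero_smul] at hC
      exact (h.mem_punctured hC).2 rfl
    · have := h.cone.smul_mem _ (inv_pos.2 ht) _ hC
      rw [inv_smul_smul₀ ht.ne'] at this
      exact hxC this
  have hmn : ∀ m n : ℕ, m ≤ n → funk C (z m) (z n) ≤ n - m := fun m n hmn => by
    have hmn' : (m : ℝ) ≤ n := by exact_mod_cast hmn
    rw [h.funk_le_iff (h.mem_punctured (z m).2.1) (z n).2.1, hz, hz]
    convert hsmul (t := Real.exp (n - m) - 1) (by simpa using hmn') using 1
    have : Real.exp (n - m : ℝ) * Real.exp (-n) = Real.exp (-m) := by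
      rw [← Real.exp_add]; congr 1; ring
    rw [smul_add, smul_smul, smul_smul, mul_sub, this]
    module
  have hlim : Tendsto (fun n => (z n : E)) atTop (𝓝 x) := by
    have he : Tendsto (fun n : ℕ => Real.exp (-n)) atTop (𝓝 0) :=
      Real.tendsto_exp_neg_atTop_nhds_zero.comp tendsto_natCast_atTop_atTop
    simpa using (he.smul_const b).add (((tendsto_const_nhds (x := (1 : ℝ))).sub he).smul_const x)
  let U : Ultrafilter ℕ := Ultrafilter.of atTop
  have hU : (U : Filter ℕ) ≤ atTop := Ultrafilter.of_le _
  obtain ⟨f, hf⟩ := h.exists_tendsto_fC U fun n => ofSection (z n)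
  refine ⟨fun p => f (ofSection p), h.mem_funkBusemannAt hx (G := U.map z)
    (tendsto_map'_iff.2 (hlim.mono_left hU)) (fun p => tendsto_map'_iff.2 ?_)
    (tendsto_map'_iff.2 ?_)⟩
  · refine (hf (ofSection p)).congr fun n => ?_
    exact (h.distFun_funkD (z n) p).symm
  · refine tendsto_const_nhds.congr fun m => ?_
    refine le_antisymm (h.funk_add_nonneg_of_tendsto hf (ofSection (z m))) ?_
    have hfm : f (ofSection (z m)) ≤ -m := by
      refine le_of_tendsto (hf (ofSection (z m))) (hU ?_)
      filter_upwards [eventually_ge_atTop m] with n hn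
      rw [h.fC_apply (ofSection (z n)).2]
      have h1 := hmn m n hn
      have h2 := hge n
      change funk C (z m) (z n) - funk C b (z n) ≤ -m
      linarith
    have := hle m
    change funk C b (z m) + f (ofSection (z m)) ≤ 0
    linarith

/-- For `f ∈ B(x)`, there is a family along which the detour costs of `r_x` and of `f` to
themselves both vanish. -/
theorem exists_common_detour (h : IsBasedCone C φ b) (hx : x ∈ sectionBoundary C φ)
    {f : crossSection C φ → ℝ} (hf : f ∈ funkBusemannAt C φ ⟨b, h.base⟩ x) :
    ∃ G : Filter C, NeBot G ∧ (∀ p, Tendsto (fun z : C => rC C b z p) G (𝓝 (rC C b x p))) ∧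
      (∀ p, Tendsto (fun z : C => fC C b z p) G (𝓝 (h.ext f p))) ∧
      Tendsto (fun z : C => funk C z b + rC C b x z) G (𝓝 0) ∧
      Tendsto (fun z : C => funk C b z + h.ext f z) G (𝓝 0) := by
  obtain ⟨hxK, hx1⟩ := h.closure_crossSection hx.1
  have hxC := h.sectionBoundary_notMem hx
  obtain ⟨hB, z, hzx, hzf⟩ := hf
  obtain ⟨G, _, hGf, hG0⟩ := hB.hasZeroDetour h.isAsymmDist_funkD
  have hzf := tendsto_apply_of_tendsto_toFunSpace h.isAsymmDist_funkD hzf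
  simp only [h.distFun_funkD] at hGf hzf
  have hzf := h.tendsto_fC_ext (u := fun n => ofSection (z n)) hzf
  have hGf := h.tendsto_fC_ext (u := fun γ => ofSection γ) hGf
  let ε : ℕ → ℝ := fun n => 1 / ((n : ℝ) + 1)
  have hε : ∀ n, 0 < ε n := fun n => by positivity
  -- Adding `x` forces `x ≤ u`, which makes the cost of `r_x` vanish as `u → x`. Since `ε γ ≤ u` and
  -- `f(u) ≤ f(γ) + log ε`, the terms `log ε` cancel and the Funk cost along `u` is at most that
  -- along `γ`, uniformly in `ε`.
  let u : crossSection C φ × ℕ → C := fun q => ⟨x + ε q.2 • (q.1 : E), by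
    rw [add_comm]
    exact h.cone.add_mem (h.cone.smul_mem _ (hε _) _ q.1.2.1) hxK.1⟩
  have hu : ∀ q, (u q : E) = x + ε q.2 • (ofSection q.1 : E) := fun q => rfl
  have hfu : ∀ q, h.ext f (u q) ≤ h.ext f (ofSection q.1) + Real.log (ε q.2) := fun q =>
    h.apply_le_of_eq_add_smul hzf hzx hxC (hε _) (hu q)
  have hFu : ∀ (p : C) q, funk C p (u q) ≤ funk C p q.1 - Real.log (ε q.2) := fun p q => by
    rw [← h.funk_smul_right (h.mem_punctured p.2) q.1.2.1 (hε _)]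
    have hεq := h.cone.smul_mem _ (hε q.2) _ q.1.2.1
    have h1 := h.funk_triangle (h.mem_punctured p.2) hεq (u q).2
    have h2 : funk C (ε q.2 • (q.1 : E)) (u q) ≤ 0 := by
      rw [h.funk_le_iff (h.mem_punctured hεq) (u q).2, Real.exp_zero, one_smul, hu]
      convert hxK.1 using 1
      change x + ε q.2 • (q.1 : E) - ε q.2 • (q.1 : E) = x
      abel
    linarith
  have h0' : Tendsto (fun q : crossSection C φ × ℕ => funk C b q.1 + h.ext f (ofSection q.1))
      (G ×ˢ atTop) (𝓝 0) := by
    simp only [h.ext_ofSection]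
    exact hG0.comp tendsto_fst
  have h0 : Tendsto (fun q => funk C b (u q) + h.ext f (u q)) (G ×ˢ atTop) (𝓝 0) := by
    refine squeeze_zero (fun q => h.funk_add_nonneg_of_tendsto hzf (u q)) (fun q => ?_) h0'
    have h1 := hfu q
    have h2 := hFu ⟨b, h.base_mem⟩ q
    dsimp only at h2
    linarith
  have hux : Tendsto (fun q => (u q : E)) (G ×ˢ atTop) (𝓝 x) := by
    obtain ⟨R, hR⟩ := h.isCompact_section.isBounded.exists_norm_le
    have hbd : Tendsto (fun q : crossSection C φ × ℕ => ε q.2 • (q.1 : E)) (G ×ˢ atTop) (𝓝 0) := by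
      have hεR : Tendsto (fun q : crossSection C φ × ℕ => ε q.2 * R) (G ×ˢ atTop) (𝓝 0) := by
        have := ((tendsto_one_div_add_atTop_nhds_zero_nat (𝕜 := ℝ)).comp
          (tendsto_snd (f := G) (g := atTop))).mul_const R
        rwa [zero_mul] at this
      refine squeeze_zero_norm (fun q => ?_) hεR
      rw [norm_smul, Real.norm_of_nonneg (hε _).le]
      exact mul_le_mul_of_nonneg_left (hR _ ⟨subset_closure q.1.2.1, q.1.2.2⟩) (hε _).le
    simpa using (tendsto_const_nhds (x := x)).add hbd
  refine ⟨(G ×ˢ atTop).map u, inferInstance, fun p => tendsto_map'_iff.2 (h.tendsto_rC hxK hux p),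
    fun p => tendsto_map'_iff.2 ?_, tendsto_map'_iff.2 ?_, tendsto_map'_iff.2 h0⟩
  -- The value of `f_u` at `p` is squeezed: `f` being nonexpansive bounds it below by `f(p)` minus
  -- the cost along `u`, and `ε γ ≤ u` bounds it above by `f_γ(p)` plus the cost along `γ`.
  · have hlow : Tendsto (fun q => h.ext f p - (funk C b (u q) + h.ext f (u q))) (G ×ˢ atTop)
        (𝓝 (h.ext f p)) := by
      simpa using (tendsto_const_nhds (x := h.ext f p)).sub h0
    have hupp : Tendsto (fun q : crossSection C φ × ℕ => fC C b q.1 p +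
        (funk C b q.1 + h.ext f (ofSection q.1))) (G ×ˢ atTop) (𝓝 (h.ext f p)) := by
      have := ((hGf p).comp (tendsto_fst (f := G) (g := atTop))).add h0'
      rwa [add_zero] at this
    refine tendsto_of_tendsto_of_tendsto_of_le_of_le hlow hupp (fun q => ?_) fun q => ?_
    · have := h.sub_le_funk_of_tendsto hzf p (u q)
      dsimp only [Function.comp_apply]
      rw [h.fC_apply (u q).2]
      linarith
    · have h1 := hFu p q
      have h2 := h.funk_add_nonneg_of_tendsto hzf (u q)
      have h3 := hfu q
      dsimp only [Function.comp_apply]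
      rw [h.fC_apply (u q).2, h.fC_apply q.1.2.1]
      linarith
  · have hlim : Tendsto (fun q => funk C (u q) b - funk C x b) (G ×ˢ atTop) (𝓝 0) := by
      simpa using (h.tendsto_funk_left hux (fun q => h.mem_punctured (u q).2) hxK
        h.base_mem).sub_const (funk C x b)
    refine squeeze_zero (fun q => ?_) (fun q => ?_) hlim
    · have := h.funk_triangle hxK (u q).2 h.base_mem
      dsimp only [Function.comp_apply]
      rw [rC_apply]
      linarith
    · have : funk C x (u q) ≤ 0 := by
        rw [h.funk_le_iff hxK (u q).2, Real.exp_zero, one_smul, hu, add_sub_cancel_left]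
        exact h.cone.smul_mem_closure (hε _) (subset_closure q.1.2.1)
      dsimp only [Function.comp_apply]
      rw [rC_apply]
      linarith

theorem hasZeroDetour_bracket_of_mem (h : IsBasedCone C φ b) (hx : x ∈ sectionBoundary C φ)
    {f : crossSection C φ → ℝ} (hf : f ∈ funkBusemannAt C φ ⟨b, h.base⟩ x) (c : EReal) :
    HasZeroDetour (thompsonC C) ⟨b, h.base_mem⟩ (bracket (rC C b x) (h.ext f) c) := by
  obtain ⟨G, _, h1, h2, h3, h4⟩ := h.exists_common_detour hx hf
  exact h.hasZeroDetour_bracket (h.rC_scale (h.closure_crossSection hx.1).1) (h.ext_scale f)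
    h1 h2 h3 h4 c

theorem hasZeroDetour_rD (h : IsBasedCone C φ b) (hx : x ∈ sectionBoundary C φ) :
    HasZeroDetour (revFunkD C φ) ⟨b, h.base⟩ (rD C φ b x) := by
  obtain ⟨f, hf⟩ := h.funkBusemannAt_nonempty hx
  obtain ⟨G, _, h1, -, h3, -⟩ := h.exists_common_detour hx hf
  refine HasZeroDetour.of_tendsto (G := G) (u := h.proj) (fun p => ?_) ?_
  · refine (h1 (ofSection p)).congr fun z => ?_
    rw [← h.rC_proj]
    rfl
  · refine h3.congr fun z => ?_
    rw [← h.funk_add_rC_proj (h.closure_crossSection hx.1).1]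
    rfl

end FiniteDimensional

end IsBasedCone

/-! ### Suprema of differences of brackets. -/

section Supremum

theorem iSup_coe_add_coe {ι : Type*} (u : ι → ℝ) (t : ℝ) :
    ⨆ i, ((u i + t : ℝ) : EReal) = (⨆ i, (u i : EReal)) + t := by
  refine le_antisymm (iSup_le fun i => ?_) ?_
  · rw [EReal.coe_add]
    gcongr
    exact le_iSup (fun i => (u i : EReal)) i
  · refine EReal.add_le_of_le_sub (iSup_le fun i => ?_)
    refine EReal.le_sub_iff_add_le (.inl (EReal.coe_ne_bot t)) (.inl (EReal.coe_ne_top t)) |>.2 ?_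
    rw [← EReal.coe_add]
    exact le_iSup (fun i => ((u i + t : ℝ) : EReal)) i

variable {X : Type*} {σ : ℝ → X → X} {r f r' f' : X → ℝ}

theorem le_bracket (r f : X → ℝ) {c : EReal} (hc : c ≠ ⊥) (z : X) :
    r z + (min c 0).toReal ≤ bracket r f c z := by
  induction c with
  | bot => exact absurd rfl hc
  | top => simp
  | coe c =>
    rw [bracket_coe, ← EReal.coe_zero, ← EReal.coe_strictMono.monotone.map_min, EReal.toReal_coe]
    exact le_max_left _ _

theorem exists_bracket_le (hr : ∀ s z, r (σ s z) = r z - s) (hf : ∀ s z, f (σ s z) = f z + s)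
    {c : EReal} (hc : c ≠ ⊥) (z : X) :
    ∃ s, bracket r f c (σ s z) ≤ r (σ s z) + (min c 0).toReal := by
  induction c with
  | bot => exact absurd rfl hc
  | top => exact ⟨0, by simp⟩
  | coe c =>
    -- This shift makes the two entries of the bracket equal.
    refine ⟨(r z + min c 0 - (f z - max c 0)) / 2, ?_⟩
    rw [bracket_coe, ← EReal.coe_zero, ← EReal.coe_strictMono.monotone.map_min, EReal.toReal_coe]
    refine max_le le_rfl ?_
    rw [hr, hf]
    linarith

variable [Nonempty X]

theorem iSup_coe_ne_bot (u : X → ℝ) : ⨆ p, (u p : EReal) ≠ ⊥ :=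
  let ⟨p⟩ := ‹Nonempty X›
  ne_bot_of_le_ne_bot (EReal.coe_ne_bot (u p)) (le_iSup (fun p => (u p : EReal)) p)

/-- A bracket is at least `r + c⁻`, with equality somewhere on each ray if `c ≠ ⊥`, while `r' - r`
is constant on rays. If `c = ⊥`, the bracket is `f` and `r' - f` is unbounded on a ray, in agreement
with subtracting `⊥`. -/
theorem iSup_sub_bracket (hr : ∀ s z, r (σ s z) = r z - s) (hf : ∀ s z, f (σ s z) = f z + s)
    (hr' : ∀ s z, r' (σ s z) = r' z - s) (c : EReal) (k : ℝ) :
    ⨆ p, ((r' p + k - bracket r f c p : ℝ) : EReal) =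
      (⨆ p, ((r' p - r p : ℝ) : EReal)) + k - min c 0 := by
  obtain ⟨z⟩ := ‹Nonempty X›
  by_cases hc : c = ⊥
  · subst hc
    have hne : (⨆ p, ((r' p - r p : ℝ) : EReal)) + k ≠ ⊥ := by
      rw [← iSup_coe_add_coe]
      exact iSup_coe_ne_bot _
    rw [min_eq_left bot_le, EReal.sub_bot hne, bracket_bot, EReal.eq_top_iff_forall_lt]
    intro K
    refine lt_of_lt_of_le ?_ (le_iSup (fun p => ((r' p + k - f p : ℝ) : EReal))
      (σ ((r' z + k - f z - K - 1) / 2) z))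
    rw [EReal.coe_lt_coe_iff, hr', hf]
    linarith
  · have hm : ((min c 0).toReal : EReal) = min c 0 := by
      refine EReal.coe_toReal ?_ ?_
      · exact ne_top_of_le_ne_top EReal.zero_ne_top (min_le_right c 0)
      · rcases min_choice c 0 with h | h <;> rw [h]
        · exact hc
        · exact EReal.zero_ne_bot
    have hb := le_bracket r f hc
    have hex := exists_bracket_le hr hf hc
    rw [← hm]
    generalize (min c 0).toReal = m at hb hex
    rw [sub_eq_add_neg, add_assoc, ← EReal.coe_neg, ← EReal.coe_add, ← iSup_coe_add_coe]
    refine le_antisymm (iSup_mono fun p => ?_) (iSup_le fun p => ?_)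
    · rw [EReal.coe_le_coe_iff]
      linarith [hb p]
    · obtain ⟨s, hs⟩ := hex p
      refine le_trans ?_ (le_iSup (fun p => ((r' p + k - bracket r f c p : ℝ) : EReal)) (σ s p))
      rw [EReal.coe_le_coe_iff, hr']
      rw [hr] at hs
      linarith

/-- The mirror image under reversal of the scaling and `c ↦ -c`. -/
theorem iSup_sub_bracket_right (hr : ∀ s z, r (σ s z) = r z - s)
    (hf : ∀ s z, f (σ s z) = f z + s) (hf' : ∀ s z, f' (σ s z) = f' z + s) (c : EReal) (k : ℝ) :
    ⨆ p, ((f' p + k - bracket r f c p : ℝ) : EReal) =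
      (⨆ p, ((f' p - f p : ℝ) : EReal)) + k - -max c 0 := by
  have := iSup_sub_bracket (σ := fun s => σ (-s)) (r := f) (f := r) (r' := f')
    (fun s z => by rw [hf, sub_eq_add_neg]) (fun s z => by rw [hr, sub_neg_eq_add])
    (fun s z => by rw [hf', sub_eq_add_neg]) (-c) k
  rw [bracket_neg] at this
  have hneg : -max c 0 = min (-c) (-0) :=
    (EReal.min_neg_neg c 0).symm
  rw [this, hneg, neg_zero]

theorem iSup_bracket_sub_bracket (hr : ∀ s z, r (σ s z) = r z - s)
    (hf : ∀ s z, f (σ s z) = f z + s) (hr' : ∀ s z, r' (σ s z) = r' z - s)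
    (hf' : ∀ s z, f' (σ s z) = f' z + s) (c c' : EReal) :
    ⨆ p, ((bracket r' f' c' p - bracket r f c p : ℝ) : EReal) =
      max ((⨆ p, ((r' p - r p : ℝ) : EReal)) + min c' 0 - min c 0)
        ((⨆ p, ((f' p - f p : ℝ) : EReal)) + -max c' 0 - -max c 0) := by
  have h1 := iSup_sub_bracket hr hf hr' c
  have h2 := iSup_sub_bracket_right hr hf hf' c
  induction c' with
  -- Here the reverse-Funk term is `⊥`, because `⊥` absorbs, and drops out of the maximum.
  | bot =>
    have h2 := h2 0
    rw [EReal.coe_zero] at h2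
    rw [bracket_bot, min_eq_left bot_le, max_eq_right bot_le, neg_zero, ← h2, EReal.add_bot,
      sub_eq_add_neg, EReal.bot_add, max_eq_right bot_le]
    simp
  | top =>
    have h1 := h1 0
    rw [EReal.coe_zero] at h1
    rw [bracket_top, min_eq_right le_top, max_eq_left le_top, EReal.neg_top, ← h1, EReal.add_bot,
      sub_eq_add_neg ⊥, EReal.bot_add, max_eq_left bot_le]
    simp
  | coe c' =>
    rw [← EReal.coe_zero, ← EReal.coe_strictMono.monotone.map_min,
      ← EReal.coe_strictMono.monotone.map_max, ← EReal.coe_neg, EReal.coe_zero, ← h1, ← h2]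
    change _ = _ ⊔ _
    rw [← iSup_sup_eq]
    refine iSup_congr fun p => ?_
    rw [bracket_coe, ← max_sub_sub_right, EReal.coe_strictMono.monotone.map_max,
      sub_eq_add_neg (f' p)]

end Supremum

/-! ### Detour costs and Busemann points of the Thompson geometry. -/

namespace IsBasedCone

variable {E : Type*} [NormedAddCommGroup E] [NormedSpace ℝ E]
variable {C : Set E} {φ : E →ₗ[ℝ] ℝ} {b x y : E}

/-- Scaling by `exp s` increases `f_{C,y} - r_x` by `2s`. -/
theorem detourCost_rC_fC (h : IsBasedCone C φ b) (hx : x ∈ C) (hy : y ∈ C) :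
    detourCost (thompsonC C) ⟨b, h.base_mem⟩ (rC C b x) (fC C b y) = ⊤ := by
  rw [EReal.eq_top_iff_forall_lt]
  intro K
  let z : C := h.scale ((K + 1 - (fC C b y ⟨b, h.base_mem⟩ - rC C b x ⟨b, h.base_mem⟩)) / 2)
    ⟨b, h.base_mem⟩
  refine lt_of_lt_of_le ?_ (sub_le_detourCost h.isAsymmDist_thompsonC (h.isNonexpansive_fC hy) z)
  rw [EReal.coe_lt_coe_iff, h.fC_scale hy, h.rC_scale (h.mem_punctured hx)]
  linarith

theorem iSup_crossSection (h : IsBasedCone C φ b) {g : C → ℝ}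
    (hg : ∀ s z, g (h.scale s z) = g z) :
    ⨆ p : crossSection C φ, (g (ofSection p) : EReal) = ⨆ p : C, (g p : EReal) := by
  have hsurj : Function.Surjective h.proj := fun p => ⟨ofSection p, h.proj_ofSection p⟩
  rw [← hsurj.iSup_comp]
  exact iSup_congr fun z => by rw [h.apply_proj hg]

/-- `d_T(b, z) + r_y(z)` is at least the scale-invariant sum `F(z, b) + r_y(z)`; evaluated on the
section, this is at least `F(y, z) - F(y, b)`, which blows up at the boundary. -/
theorem detourCost_rC_eq_top (h : IsBasedCone C φ b) {ξ : C → ℝ} {G : Filter C} [NeBot G]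
    (hξ : Tendsto (fun z => thompsonC C ⟨b, h.base_mem⟩ z + ξ z) G (𝓝 0))
    (hG : Tendsto (fun z => (h.proj z : E)) G (𝓝 x)) (hx : x ∉ C) (hy : y ∈ C) :
    detourCost (thompsonC C) ⟨b, h.base_mem⟩ ξ (rC C b y) = ⊤ := by
  have hyK := h.mem_punctured hy
  refine detourCost_eq_top h.isAsymmDist_thompsonC (h.isNonexpansive_rC hyK) hξ ?_
  refine tendsto_atTop_mono (fun z => ?_) (tendsto_atTop_add_const_right _ (-funk C y b)
    (h.tendsto_funk_atTop hG (fun z => (h.proj z).2.1) hy hx))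
  have h1 := h.funk_nonneg (h.mem_punctured (h.proj z).2.1) (h.proj z).2.2 h.base.1 h.base.2
  have h2 := h.funk_add_rC_proj hyK z
  have h3 : funk C z b ≤ thompsonC C ⟨b, h.base_mem⟩ z := by
    rw [h.thompsonC_eq]
    exact le_max_right _ _
  have h4 := rC_apply (b := b) y (ofSection (h.proj z))
  change rC C b y (ofSection (h.proj z)) = funk C y (h.proj z) - funk C y b at h4
  linarith

theorem detourCost_fC_eq_top (h : IsBasedCone C φ b) {ξ : C → ℝ} {G : Filter C} [NeBot G]
    (hξ : Tendsto (fun z => thompsonC C ⟨b, h.base_mem⟩ z + ξ z) G (𝓝 0))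
    (hG : Tendsto (fun z => (h.proj z : E)) G (𝓝 x)) (hx : x ∉ C)
    (hy : y ∈ crossSection C φ) :
    detourCost (thompsonC C) ⟨b, h.base_mem⟩ ξ (fC C b y) = ⊤ := by
  refine detourCost_eq_top h.isAsymmDist_thompsonC (h.isNonexpansive_fC hy.1) hξ ?_
  refine tendsto_atTop_mono (fun z => ?_) (tendsto_atTop_add_const_right _ (-funk C b y)
    (h.tendsto_funk_atTop hG (fun z => (h.proj z).2.1) h.base_mem hx))
  have h1 := h.funk_nonneg (h.mem_punctured (h.proj z).2.1) (h.proj z).2.2 hy.1 hy.2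
  have h2 := h.funk_add_proj (h.fC_scale hy.1) z
  have h3 : funk C b z ≤ thompsonC C ⟨b, h.base_mem⟩ z := by
    rw [h.thompsonC_eq]
    exact le_max_left _ _
  have h4 : fC C b y (ofSection (h.proj z)) = funk C (h.proj z) y - funk C b y :=
    h.fC_apply hy.1 _
  linarith

/-- Non-negativity of the other cost matters, since `⊤ + ⊥ = ⊥`. -/
theorem detourDist_eq_top (h : IsBasedCone C φ b) {ξ η : C → ℝ}
    (hξ : IsBusemann (thompsonC C) ⟨b, h.base_mem⟩ ξ)
    (hη : IsBusemann (thompsonC C) ⟨b, h.base_mem⟩ η)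
    (htop : detourCost (thompsonC C) ⟨b, h.base_mem⟩ ξ η = ⊤ ∨
      detourCost (thompsonC C) ⟨b, h.base_mem⟩ η ξ = ⊤) :
    detourDist (thompsonC C) ⟨b, h.base_mem⟩ ξ η = ⊤ := by
  have hd := h.isAsymmDist_thompsonC
  have hne : ∀ {ξ η : C → ℝ}, IsBusemann (thompsonC C) ⟨b, h.base_mem⟩ ξ →
      IsBusemann (thompsonC C) ⟨b, h.base_mem⟩ η →
      detourCost (thompsonC C) ⟨b, h.base_mem⟩ ξ η ≠ ⊥ := fun {ξ η} hξ hη =>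
    ne_bot_of_le_ne_bot EReal.zero_ne_bot (detourCost_nonneg hd
      ((hη.hasZeroDetour hd).isNonexpansive hd) (hξ.hasZeroDetour hd).apply_base
      (hη.hasZeroDetour hd).apply_base)
  rcases htop with ht | ht
  · rw [detourDist, ht, EReal.top_add_of_ne_bot (hne hη hξ)]
  · rw [detourDist, ht, EReal.add_top_of_ne_bot (hne hξ hη)]

section FiniteDimensional

variable [FiniteDimensional ℝ E]

/-- The triangle inequality through `x` bounds the supremum, and `p = x` attains it. -/
theorem detourCost_rC (h : IsBasedCone C φ b) (hx : x ∈ C) (hy : y ∈ C) :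
    detourCost (thompsonC C) ⟨b, h.base_mem⟩ (rC C b x) (rC C b y) =
      ((funk C y x - funk C y b + funk C x b : ℝ) : EReal) := by
  rw [(h.hasZeroDetour_rC hx).detourCost_eq h.isAsymmDist_thompsonC h.hasFiniteNets_thompsonC
    (h.isNonexpansive_rC (h.mem_punctured hy))]
  refine le_antisymm (iSup_le fun p => ?_) ?_
  · have := h.funk_triangle (h.mem_punctured hy) hx p.2
    rw [EReal.coe_le_coe_iff, rC_apply, rC_apply]
    linarith
  · refine le_trans ?_ (le_iSup (fun p => ((rC C b y p - rC C b x p : ℝ) : EReal)) ⟨x, hx⟩)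
    have := h.funk_self hx
    rw [EReal.coe_le_coe_iff, rC_apply, rC_apply]
    dsimp only
    linarith

theorem detourCost_fC (h : IsBasedCone C φ b) (hx : x ∈ C) (hy : y ∈ C) :
    detourCost (thompsonC C) ⟨b, h.base_mem⟩ (fC C b x) (fC C b y) =
      ((funk C x y - funk C b y + funk C b x : ℝ) : EReal) := by
  rw [(h.hasZeroDetour_fC hx).detourCost_eq h.isAsymmDist_thompsonC h.hasFiniteNets_thompsonC
    (h.isNonexpansive_fC hy)]
  refine le_antisymm (iSup_le fun p => ?_) ?_
  · have := h.funk_triangle (h.mem_punctured p.2) hx hy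
    rw [EReal.coe_le_coe_iff, h.fC_apply hx, h.fC_apply hy]
    linarith
  · refine le_trans ?_ (le_iSup (fun p => ((fC C b y p - fC C b x p : ℝ) : EReal)) ⟨x, hx⟩)
    have := h.funk_self hx
    rw [EReal.coe_le_coe_iff, h.fC_apply hx, h.fC_apply hy]
    dsimp only
    linarith

theorem detourCost_bracket (h : IsBasedCone C φ b) (hx : x ∈ sectionBoundary C φ)
    (hy : y ∈ sectionBoundary C φ) {f g : crossSection C φ → ℝ}
    (hf : f ∈ funkBusemannAt C φ ⟨b, h.base⟩ x) (hg : g ∈ funkBusemannAt C φ ⟨b, h.base⟩ y)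
    (c c' : EReal) :
    detourCost (thompsonC C) ⟨b, h.base_mem⟩ (bracket (rC C b x) (h.ext f) c)
        (bracket (rC C b y) (h.ext g) c') =
      max
        (shiftedDetourCost (revFunkD C φ) ⟨b, h.base⟩ (rD C φ b x) (min c 0)
          (rD C φ b y) (min c' 0))
        (shiftedDetourCost (funkD C φ) ⟨b, h.base⟩ f (-(max c 0)) g (-(max c' 0))) := by
  have hxK := (h.closure_crossSection hx.1).1
  have hyK := (h.closure_crossSection hy.1).1
  have : Nonempty C := ⟨⟨b, h.base_mem⟩⟩
  rw [(h.hasZeroDetour_bracket_of_mem hx hf c).detourCost_eq h.isAsymmDist_thompsonC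
      h.hasFiniteNets_thompsonC ((h.hasZeroDetour_bracket_of_mem hy hg c').isNonexpansive
        h.isAsymmDist_thompsonC),
    iSup_bracket_sub_bracket (h.rC_scale hxK) (h.ext_scale f) (h.rC_scale hyK) (h.ext_scale g),
    shiftedDetourCost, shiftedDetourCost,
    (h.hasZeroDetour_rD hx).detourCost_eq h.isAsymmDist_revFunkD h.hasFiniteNets_revFunkD
      ((h.hasZeroDetour_rD hy).isNonexpansive h.isAsymmDist_revFunkD),
    (hf.1.hasZeroDetour h.isAsymmDist_funkD).detourCost_eq h.isAsymmDist_funkD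
      h.hasFiniteNets_funkD ((hg.1.hasZeroDetour h.isAsymmDist_funkD).isNonexpansive
        h.isAsymmDist_funkD),
    ← h.iSup_crossSection (g := fun p => rC C b y p - rC C b x p) (fun s z => by
      rw [h.rC_scale hxK, h.rC_scale hyK]; ring),
    ← h.iSup_crossSection (g := fun p => h.ext g p - h.ext f p) (fun s z => by
      rw [h.ext_scale, h.ext_scale]; ring)]
  simp only [h.ext_ofSection]
  rfl

/-- The Busemann points of the Thompson geometry. -/
theorem isBusemann_thompsonC (h : IsBasedCone C φ b) {ξ : C → ℝ}
    (hξ : IsBusemann (thompsonC C) ⟨b, h.base_mem⟩ ξ) :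
    (∃ x ∈ crossSection C φ, ξ = rC C b x) ∨ (∃ x ∈ crossSection C φ, ξ = fC C b x) ∨
      (∃ x ∈ sectionBoundary C φ, ∃ f ∈ funkBusemannAt C φ ⟨b, h.base⟩ x, ∃ c : EReal,
        ξ = bracket (rC C b x) (h.ext f) c) ∧
      ∀ y ∈ crossSection C φ,
        detourCost (thompsonC C) ⟨b, h.base_mem⟩ ξ (rC C b y) = ⊤ ∧
        detourCost (thompsonC C) ⟨b, h.base_mem⟩ ξ (fC C b y) = ⊤ := by
  obtain ⟨U, hψ, h0⟩ := (hξ.hasZeroDetour h.isAsymmDist_thompsonC).exists_ultrafilter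
  obtain ⟨x, -, hx⟩ := h.isCompact_section.ultrafilter_le_nhds (U.map fun z => (h.proj z : E)) (by
    rw [Ultrafilter.coe_map, le_principal_iff, mem_map]
    exact univ_mem' fun z => ⟨subset_closure (h.proj z).2.1, (h.proj z).2.2⟩)
  obtain ⟨c, -, hc⟩ := isCompact_univ.ultrafilter_le_nhds
    (U.map fun z : C => ((funk C z b - funk C b z : ℝ) : EReal)) (by simp)
  replace hx : Tendsto (fun z => (h.proj z : E)) U (𝓝 x) := hx
  replace hc : Tendsto (fun z : C => ((funk C z b - funk C b z : ℝ) : EReal)) U (𝓝 c) := hc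
  have hxcl : x ∈ closure (crossSection C φ) :=
    mem_closure_of_tendsto hx (Eventually.of_forall fun z => (h.proj z).2)
  obtain ⟨hxK, hx1⟩ := h.closure_crossSection hxcl
  obtain ⟨f, hf⟩ := h.exists_tendsto_fC U id
  have hr : ∀ p, Tendsto (fun z : C => rC C b z p) U (𝓝 (rC C b x p)) := fun p => by
    refine (h.tendsto_rC (u := fun z => ofSection (h.proj z)) hxK hx p).congr fun z => ?_
    exact congrFun (h.rC_proj z) p
  have hξeq : ξ = bracket (rC C b x) f c :=
    funext fun p => tendsto_nhds_unique (hψ p) (h.tendsto_distFun_thompsonC hr hf hc p)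
  by_cases hxC : x ∈ C
  · have hfx : f = fC C b x := funext fun p => by
      refine tendsto_nhds_unique (hf p) ?_
      have := h.tendsto_fC (u := fun z => ofSection (h.proj z)) hxC hx p
      refine this.congr fun z => ?_
      exact congrFun (h.fC_proj z) p
    subst hfx
    induction c with
    | bot => exact .inr (.inl ⟨x, ⟨hxC, hx1⟩, by rw [hξeq, bracket_bot]⟩)
    | top => exact .inl ⟨x, ⟨hxC, hx1⟩, by rw [hξeq, bracket_top]⟩
    | coe c =>
      -- With `x` interior and `c` finite, `ξ` would be `ψ` of the multiple of `x` that realises the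
      -- parameter `c`, hence no horofunction.
      refine absurd ?_ hξ.1.2
      refine ⟨h.scale ((c - (funk C x b - funk C b x)) / 2) ⟨x, hxC⟩, ?_⟩
      rw [h.distFun_thompsonC, h.rC_scale_point, h.fC_scale_point, h.funk_scale_left _ _ h.base_mem,
        h.funk_scale_right _ _ (h.mem_punctured h.base_mem), hξeq]
      congr 2
      dsimp only
      ring
  · have hxb : x ∈ sectionBoundary C φ := ⟨hxcl, fun hxD => hxC hxD.1⟩
    refine .inr (.inr ⟨⟨x, hxb, ?_⟩, fun y hy => ⟨h.detourCost_rC_eq_top h0 hx hxC hy.1,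
      h.detourCost_fC_eq_top h0 hx hxC hy⟩⟩)
    -- When `c = ⊤` the Funk entry is invisible and its limit need not have zero detour, so any
    -- element of `B(x)` is used instead.
    by_cases hct : c = ⊤
    · obtain ⟨g, hg⟩ := h.funkBusemannAt_nonempty hxb
      exact ⟨g, hg, ⊤, by rw [hξeq, hct, bracket_top, bracket_top]⟩
    have hfext : f = h.ext fun p => f (ofSection p) := funext fun p =>
      tendsto_nhds_unique (hf p) (h.tendsto_fC_ext (fun q => hf (ofSection q)) p)
    refine ⟨fun p => f (ofSection p), h.mem_funkBusemannAt hxb (G := (U : Filter C).map h.proj)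
      (tendsto_map'_iff.2 hx) (fun p => tendsto_map'_iff.2 ?_) (tendsto_map'_iff.2 ?_), c,
      by rw [← hfext, hξeq]⟩
    · refine (hf (ofSection p)).congr fun z => ?_
      rw [Function.comp_apply, h.distFun_funkD, h.fC_proj]
      rfl
    · have hcmax : Tendsto (fun z : C => max (funk C z b - funk C b z) 0) U
          (𝓝 (max c 0).toReal) := by
        have := (EReal.tendsto_toReal (a := max c 0) (by
          rcases max_choice c 0 with h | h <;> rw [h]
          · exact hct
          · exact EReal.zero_ne_top)
          (ne_bot_of_le_ne_bot EReal.zero_ne_bot (le_max_right c 0))).comp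
          (hc.max (tendsto_const_nhds (x := (0 : EReal))))
        refine this.congr fun z => ?_
        rw [Function.comp_apply, ← EReal.coe_zero, ← EReal.coe_strictMono.monotone.map_max,
          EReal.toReal_coe]
      -- Since `d_T(b, z) = F(b, z) + (F(z, b) - F(b, z))⁺` and `ξ ≥ f - c⁺`, this vanishing
      -- quantity dominates the Funk sum `F(b, z) + f(z) ≥ 0`.
      have hlim : Tendsto (fun z => thompsonC C ⟨b, h.base_mem⟩ z + ξ z +
          ((max c 0).toReal - max (funk C z b - funk C b z) 0)) U (𝓝 0) := by
        simpa using h0.add ((tendsto_const_nhds (x := (max c 0).toReal)).sub hcmax)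
      have hfs : ∀ s z, f (h.scale s z) = f z + s := fun s z => by
        rw [hfext]
        exact h.ext_scale _ s z
      have hsq : Tendsto (fun z : C => funk C b z + f z) U (𝓝 0) := by
        refine squeeze_zero (fun z => h.funk_add_nonneg_of_tendsto hf z) (fun z => ?_) hlim
        have h1 := sub_le_bracket (rC C b x) f hct z
        rw [← hξeq] at h1
        have h2 : thompsonC C ⟨b, h.base_mem⟩ z = funk C b z + max (funk C z b - funk C b z) 0 := by
          rw [h.thompsonC_eq, ← max_add_add_left, add_sub_cancel, add_zero, max_comm]
        linarith
      refine hsq.congr fun z => ?_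
      exact (h.funk_add_proj hfs z).symm

end FiniteDimensional

end IsBasedCone

end ThompsonGeometry


open ThompsonGeometry in
theorem mainTheorem7 {E : Type*} [NormedAddCommGroup E] [NormedSpace ℝ E] [FiniteDimensional ℝ E]
    (C : Set E) (hC : IsProperOpenConvexCone C)
    (φ : E →ₗ[ℝ] ℝ) (hφ : IsPositiveOn C φ)
    (b : E) (hb : b ∈ crossSection C φ) :
    -- both points of the form `r_x` with `x ∈ D`
    (∀ x ∈ crossSection C φ, ∀ y ∈ crossSection C φ,
      detourDist (thompsonC C) ⟨b, hb.1⟩ (rC C b x) (rC C b y) = ((hilbert C x y : ℝ) : EReal)) ∧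
    -- both points of the form `f_{C,x}` with `x ∈ D`
    (∀ x ∈ crossSection C φ, ∀ y ∈ crossSection C φ,
      detourDist (thompsonC C) ⟨b, hb.1⟩ (fC C b x) (fC C b y) = ((hilbert C x y : ℝ) : EReal)) ∧
    -- both points of the form `[r_x, f, c]` with `x ∈ ∂D` and `f ∈ B(x)`
    (∀ x ∈ sectionBoundary C φ, ∀ x' ∈ sectionBoundary C φ,
      ∀ f ∈ funkBusemannAt C φ ⟨b, hb⟩ x, ∀ f' ∈ funkBusemannAt C φ ⟨b, hb⟩ x',
      ∀ c c' : EReal,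
      detourDist (thompsonC C) ⟨b, hb.1⟩
          (bracket (rC C b x) (extendToCone hC hφ hb f) c)
          (bracket (rC C b x') (extendToCone hC hφ hb f') c') =
        max
          (shiftedDetourCost (revFunkD C φ) ⟨b, hb⟩ (rD C φ b x) (min c 0)
            (rD C φ b x') (min c' 0))
          (shiftedDetourCost (funkD C φ) ⟨b, hb⟩ f (-(max c 0)) f' (-(max c' 0))) +
        max
          (shiftedDetourCost (revFunkD C φ) ⟨b, hb⟩ (rD C φ b x') (min c' 0)
            (rD C φ b x) (min c 0))
          (shiftedDetourCost (funkD C φ) ⟨b, hb⟩ f' (-(max c' 0)) f (-(max c 0)))) ∧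
    -- all other pairs of Busemann points
    (∀ ξ η : C → ℝ, IsBusemann (thompsonC C) ⟨b, hb.1⟩ ξ → IsBusemann (thompsonC C) ⟨b, hb.1⟩ η →
      (¬ ∃ x ∈ crossSection C φ, ∃ y ∈ crossSection C φ, ξ = rC C b x ∧ η = rC C b y) →
      (¬ ∃ x ∈ crossSection C φ, ∃ y ∈ crossSection C φ, ξ = fC C b x ∧ η = fC C b y) →
      (¬ ∃ x ∈ sectionBoundary C φ, ∃ x' ∈ sectionBoundary C φ,
        ∃ f ∈ funkBusemannAt C φ ⟨b, hb⟩ x, ∃ f' ∈ funkBusemannAt C φ ⟨b, hb⟩ x',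
        ∃ c c' : EReal,
          ξ = bracket (rC C b x) (extendToCone hC hφ hb f) c ∧
          η = bracket (rC C b x') (extendToCone hC hφ hb f') c') →
      detourDist (thompsonC C) ⟨b, hb.1⟩ ξ η = ⊤) := by
  have h : IsBasedCone C φ b := ⟨hC, hφ, hb⟩
  refine ⟨fun x hx y hy => ?_, fun x hx y hy => ?_, fun x hx x' hx' f hf f' hf' c c' => ?_,
    fun ξ η hξ hη hA hB hG => ?_⟩
  · rw [detourDist, h.detourCost_rC hx.1 hy.1, h.detourCost_rC hy.1 hx.1, ← EReal.coe_add,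
      h.hilbert_eq hx.1 hy.1]
    congr 1
    ring
  · rw [detourDist, h.detourCost_fC hx.1 hy.1, h.detourCost_fC hy.1 hx.1, ← EReal.coe_add,
      h.hilbert_eq hx.1 hy.1]
    congr 1
    ring
  · exact congrArg₂ (· + ·) (h.detourCost_bracket hx hx' hf hf' c c')
      (h.detourCost_bracket hx' hx hf' hf c' c)
  · refine h.detourDist_eq_top hξ hη ?_
    rcases h.isBusemann_thompsonC hξ with ⟨x, hx, rfl⟩ | ⟨x, hx, rfl⟩ | ⟨⟨x, hx, f, hf, c, rfl⟩, hξt⟩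
    · rcases h.isBusemann_thompsonC hη with ⟨y, hy, rfl⟩ | ⟨y, hy, rfl⟩ | ⟨-, hηt⟩
      · exact absurd ⟨x, hx, y, hy, rfl, rfl⟩ hA
      · exact .inl (h.detourCost_rC_fC hx.1 hy.1)
      · exact .inr (hηt x hx).1
    · rcases h.isBusemann_thompsonC hη with ⟨y, hy, rfl⟩ | ⟨y, hy, rfl⟩ | ⟨-, hηt⟩
      · exact .inr (h.detourCost_rC_fC hy.1 hx.1)
      · exact absurd ⟨x, hx, y, hy, rfl, rfl⟩ hB
      · exact .inr (hηt x hx).2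
    · rcases h.isBusemann_thompsonC hη with ⟨y, hy, rfl⟩ | ⟨y, hy, rfl⟩ |
        ⟨⟨y, hy, g, hg, c', rfl⟩, -⟩
      · exact .inl (hξt y hy).1
      · exact .inl (hξt y hy).2
      · exact absurd ⟨x, hx, y, hy, f, hf, g, hg, c, c', rfl, rfl⟩ hG
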